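/- Let $\nu:\mathbb R\to[0,\infty)$ be a Lebesgue probability density with a first moment, $\int_{\mathbb R}|y|\,\nu(y)\,dy<\infty$. For $\alpha\in(-1,1)$ let $$P_\alpha(x,A)=\int_{\mathbb R}1_A(\alpha x+y)\,\nu(y)\,dy$$ be the transition kernel of the AR(1) chain $X_n=\alpha X_{n-1}+\vartheta_n$, where the noises $\vartheta_n$ are i.i.d. with density $\nu$ and independent of $X_0$. Put $P_\alpha f(x)=\int f(y)\,P_\alpha(x,dy)$ and $V(x)=1+|x|$. For $\beta\in[0,1]$ and measurable $f:\mathbb R\to\mathbb C$ let $\|f\|_\beta=\sup_x V(x)^{-\beta}|f(x)|$, and for a linear operator $T$ on functions let $\|T\|_{\beta,\beta'}=\sup\{\|Tf\|_{\beta'} : f \text{ measurable},\ \|f\|_\beta\le 1\}$; write $\|T\|_{\mathcal B_V}=\|T\|_{1,1}$. Then the following hold. 1. For every $\alpha\in(-1,1)$, $P_\alpha$ is $V$-geometrically ergodic: it has a unique invariant probability measure $\pi_\alpha$, one has $\pi_\alpha(V)<\infty$, and there are $c>0$ and $\kappa\in(0,1)$ (which may depend on $\alpha$ and $\nu$) such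 that $|P_\alpha^n f(x)-\pi_\alpha(f)|\le c\,\kappa^n V(x)$ for all $n\ge 0$, all $x\in\mathbb R$ and all measurable $f:\mathbb R\to\mathbb C$ with $|f|\le V$. 2. For all $0<a_0<\delta<1$ there is $L\in(0,\infty)$ such that $P_\alpha V\le \delta V+L$ on $\mathbb R$ for every $\alpha\in(-a_0,a_0)$. 3. For every $\alpha_0\in(-1,1)$, $\|P_\alpha-P_{\alpha_0}\|_{0,1}\to 0$ as $\alpha\to\alpha_0$. 4. For every $\alpha_0\in(-1,1)$, $\pi_\alpha\to\pi_{\alpha_0}$ in total variation as $\alpha\to\alpha_0$, that is, $\sup\{|\pi_\alpha(f)-\pi_{\alpha_0}(f)| : f \text{ measurable},\ \|f\|_0\le1\}\to 0$. 5. For every $\alpha_0\in(-1,1)$ with $\alpha_0\ne 0$, $\|P_\alpha-P_{\alpha_0}\|_{\mathcal B_V}$ does not tend to $0$ as $\alpha\to\alpha_0$; indeed it tends to $0$ neither as $\alpha\downarrow\alpha_0$ nor as $\alpha\uparrow\alpha_0$. -/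

import Mathlib

open MeasureTheory ProbabilityTheory Filter Topology Set
open scoped ENNReal

namespace MarkovPerturbation

noncomputable section

/-- Action of a transition kernel on functions: `(P f)(x) = ∫ f(y) P(x, dy)`. -/
def kernelOp {X : Type*} [MeasurableSpace X] (P : Kernel X X) (f : X → ℂ) : X → ℂ :=
  fun x => ∫ y, f y ∂(P x)

/-- The weighted supremum norm `‖f‖_β = sup_x V(x)^(-β) |f(x)|`, as an extended nonnegative
number. A measurable `f` lies in the space `B_β` exactly when this is finite. The weight `V` is
meant to take values in `[1, ∞)`. -/
def weightedNorm {X : Type*} (V : X → ℝ) (β : ℝ) (f : X → ℂ) : ℝ≥0∞ :=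
  ⨆ x, ENNReal.ofReal (V x ^ (-β)) * ‖f x‖ₑ

/-- The operator norm `‖T‖_{β,β'} = sup {‖T f‖_β' : f ∈ B_β, ‖f‖_β ≤ 1}`, as an extended
nonnegative number. -/
def opNorm {X : Type*} [MeasurableSpace X] (V : X → ℝ) (β β' : ℝ)
    (T : (X → ℂ) → X → ℂ) : ℝ≥0∞ :=
  ⨆ (f : X → ℂ) (_ : Measurable f) (_ : weightedNorm V β f ≤ 1), weightedNorm V β' (T f)

/-- The total variation norm `sup {|μ(f) - μ'(f)| : f measurable, sup |f| ≤ 1}`. -/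
def tvNorm {X : Type*} [MeasurableSpace X] (μ μ' : Measure X) : ℝ≥0∞ :=
  ⨆ (f : X → ℂ) (_ : Measurable f) (_ : ∀ x, ‖f x‖ ≤ 1), ‖(∫ x, f x ∂μ) - ∫ x, f x ∂μ'‖ₑ

/-- `V`-geometric ergodicity of the kernel `P` with invariant distribution `π`: `π` is the unique
invariant probability measure of `P`, `π(V) < ∞`, and there are `c > 0` and `κ ∈ (0, 1)` with
`sup_{|f| ≤ V} |P^n f(x) - π(f)| ≤ c κ^n V(x)` for all `n` and `x`. -/
structure IsVGeomErgodic {X : Type*} [MeasurableSpace X] (V : X → ℝ) (P : Kernel X X)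
    (π : Measure X) : Prop where
  isProbabilityMeasure : IsProbabilityMeasure π
  invariant : P.Invariant π
  unique : ∀ π' : Measure X, IsProbabilityMeasure π' → P.Invariant π' → π' = π
  lintegral_lt_top : ∫⁻ x, ENNReal.ofReal (V x) ∂π < ∞
  geometric : ∃ c κ : ℝ, 0 < c ∧ 0 < κ ∧ κ < 1 ∧
    ∀ (n : ℕ) (x : X) (f : X → ℂ), Measurable f → (∀ y, ‖f y‖ ≤ V y) →
      ‖kernelOp (P ^ n) f x - ∫ y, f y ∂π‖ ≤ c * κ ^ n * V x

/-- The law on `ℝ` with Lebesgue density `ν`. -/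
def noiseLaw (ν : ℝ → ℝ) : Measure ℝ :=
  volume.withDensity fun y => ENNReal.ofReal (ν y)

/-- The transition kernel of the autoregressive model `X_n = α X_{n-1} + ϑ_n`, where the i.i.d.
noises `ϑ_n` have Lebesgue density `ν`: `P_α(x, ·)` is the law of `α x + ϑ_1`. -/
def arKernel (ν : ℝ → ℝ) (α : ℝ) : Kernel ℝ ℝ where
  toFun x := (noiseLaw ν).map fun y => α * x + y
  measurable' := by
    refine Measure.measurable_of_measurable_coe _ fun A hA => ?_
    have : SFinite (noiseLaw ν) := by unfold noiseLaw; infer_instance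
    have h : Measurable fun p : ℝ × ℝ => α * p.1 + p.2 := by fun_prop
    have h2 := measurable_measure_prodMk_left (ν := noiseLaw ν) (h hA)
    convert h2 using 2 with x
    rw [Measure.map_apply (by fun_prop) hA]
    rfl

/-- `P_α(x, A) = ∫ 1_A(α x + y) ν(y) dy`. -/
theorem arKernel_apply {ν : ℝ → ℝ} (hν : Measurable ν) (α x : ℝ) {A : Set ℝ}
    (hA : MeasurableSet A) :
    arKernel ν α x A =
      ∫⁻ y, ENNReal.ofReal (ν y) * A.indicator (fun _ => (1 : ℝ≥0∞)) (α * x + y) := by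
  have hm : Measurable fun y : ℝ => α * x + y := by fun_prop
  change ((noiseLaw ν).map fun y => α * x + y) A = _
  rw [← lintegral_indicator_one hA, lintegral_map (measurable_one.indicator hA) hm, noiseLaw]
  exact lintegral_withDensity_eq_lintegral_mul _ (by fun_prop)
    ((measurable_one.indicator hA).comp hm)

/-- The weight `V(x) = 1 + |x|`. -/
def arWeight (x : ℝ) : ℝ := 1 + |x|

end

end MarkovPerturbation

open MarkovPerturbation

namespace MarkovPerturbation

/-! ### Markov kernels: drift under iteration and Harris' contraction. -/

section Kernel

variable {X : Type*} [MeasurableSpace X]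

/-! Two facts drive the positive statements. Drift: one step sends `|x|` to at most `|α| |x|` plus
the first moment of the noise, on average. Smoothing: translation is continuous in L¹, so for every
ε there is K such that shifting the noise from z to z' changes the mean of any measurable f with |f|
≤ 1 by at most ε + K|z - z'| (`exists_norm_integral_translate_sub_le`). Two copies of the chain
sharing all noises but the last approach each other by a factor |α| per step, and the last noise
smooths, which gives the bound ε + K|α|^n|x - x'| after n steps
(`norm_integral_arKernel_pow_sub_le`).

This forgetting of the initial state gives uniqueness of the invariant law. With tightness, it also
gives existence. It makes a power of the kernel satisfy the small-set condition of Harris' theorem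
without any lower bound on the density, so geometric ergodicity follows from contraction of a
weighted oscillation seminorm.

Smoothing with z = αx and z' = α₀x gives continuity in the norm from bounded functions to V-bounded
ones. For the invariant laws, π_α is compared with P_α^n(0,·) at a rate uniform for α near α₀, and
then P_α^n with P_{α₀}^n for that fixed n (`tendsto_tvNorm_invariant`); the ergodicity constants are
never compared across α.

Strong continuity fails because, for α ≠ α₀ however close, αx and α₀x are far apart once x is large.
A bump of height about |α|x around αx then separates the two kernels by a multiple of V(x)
(`exists_norm_integral_arKernel_sub_ge`). -/

instance isMarkovKernel_pow (κ : Kernel X X) [IsMarkovKernel κ] (n : ℕ) :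
    IsMarkovKernel (κ ^ n) := by
  induction n with
  | zero => rw [pow_zero]; exact inferInstanceAs (IsMarkovKernel Kernel.id)
  | succ n ih => rw [pow_succ]; exact inferInstanceAs (IsMarkovKernel ((κ ^ n) ∘ₖ κ))

theorem integrable_of_norm_le {E : Type*} [NormedAddCommGroup E] {μ : Measure X}
    [IsFiniteMeasure μ] {f : X → E} (hf : StronglyMeasurable f) {C : ℝ} (hC : ∀ x, ‖f x‖ ≤ C) :
    Integrable f μ :=
  Integrable.of_bound hf.aestronglyMeasurable C (ae_of_all _ hC)

theorem integrable_of_norm_le_add_mul {E : Type*} [NormedAddCommGroup E] {μ : Measure X}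
    [IsFiniteMeasure μ] {W : X → ℝ} (hW : Integrable W μ) {f : X → E}
    (hf : StronglyMeasurable f) {a b : ℝ} (h : ∀ x, ‖f x‖ ≤ a + b * W x) : Integrable f μ :=
  Integrable.mono' ((integrable_const a).add (hW.const_mul b)) hf.aestronglyMeasurable
    (ae_of_all _ h)

theorem norm_integral_le_add_mul {E : Type*} [NormedAddCommGroup E] [NormedSpace ℝ E]
    {μ : Measure X} [IsProbabilityMeasure μ] {W : X → ℝ} (hW : Integrable W μ) {c : ℝ}
    (hc : ∫ x, W x ∂μ ≤ c) {f : X → E} {a b : ℝ} (hb : 0 ≤ b) (h : ∀ x, ‖f x‖ ≤ a + b * W x) :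
    ‖∫ x, f x ∂μ‖ ≤ a + b * c := by
  refine (norm_integral_le_of_norm_le ((integrable_const a).add (hW.const_mul b))
    (ae_of_all _ h)).trans ?_
  rw [integral_add' (integrable_const a) (hW.const_mul b), integral_const_mul]
  simp only [integral_const, probReal_univ, one_smul]
  gcongr

theorem norm_integral_le_of_forall_norm_le {E : Type*} [NormedAddCommGroup E] [NormedSpace ℝ E]
    {μ : Measure X} [IsProbabilityMeasure μ] {f : X → E} {C : ℝ} (h : ∀ x, ‖f x‖ ≤ C) :
    ‖∫ x, f x ∂μ‖ ≤ C := by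
  simpa using norm_integral_le_of_norm_le_const (μ := μ) (ae_of_all _ h)

theorem integrable_and_integral_le_of_lintegral_le {μ : Measure X} {W : X → ℝ}
    (hWm : Measurable W) (hW : ∀ x, 0 ≤ W x) {c : ℝ} (hc : 0 ≤ c)
    (h : ∫⁻ x, ENNReal.ofReal (W x) ∂μ ≤ ENNReal.ofReal c) :
    Integrable W μ ∧ ∫ x, W x ∂μ ≤ c := by
  refine ⟨⟨hWm.aestronglyMeasurable, ?_⟩, ?_⟩
  · rw [hasFiniteIntegral_iff_ofReal (ae_of_all _ hW)]
    exact h.trans_lt ENNReal.ofReal_lt_top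
  · rw [integral_eq_lintegral_of_nonneg_ae (ae_of_all _ hW) hWm.aestronglyMeasurable]
    exact ENNReal.toReal_le_of_le_ofReal hc h

theorem lintegral_ofReal_mul_add {μ : Measure X} [IsProbabilityMeasure μ] {W : X → ℝ}
    (hWm : Measurable W) (hW : ∀ x, 0 ≤ W x) {a b : ℝ} (ha : 0 ≤ a) (hb : 0 ≤ b) :
    ∫⁻ x, ENNReal.ofReal (a * W x + b) ∂μ
      = ENNReal.ofReal a * ∫⁻ x, ENNReal.ofReal (W x) ∂μ + ENNReal.ofReal b := by
  calc ∫⁻ x, ENNReal.ofReal (a * W x + b) ∂μ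
      = ∫⁻ x, (ENNReal.ofReal a * ENNReal.ofReal (W x) + ENNReal.ofReal b) ∂μ := by
        refine lintegral_congr fun x => ?_
        rw [ENNReal.ofReal_add (mul_nonneg ha (hW x)) hb, ENNReal.ofReal_mul ha]
    _ = _ := by
        rw [lintegral_add_right _ measurable_const, lintegral_const_mul _ (by fun_prop)]
        simp

/-- A geometric drift condition passes to the powers of the kernel. -/
theorem lintegral_pow_le_of_drift (κ : Kernel X X) [IsMarkovKernel κ] {W : X → ℝ}
    (hWm : Measurable W) (hW : ∀ x, 0 ≤ W x) {a m : ℝ} (ha : 0 ≤ a) (ha1 : a < 1) (hm : 0 ≤ m)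
    (hdrift : ∀ x, ∫⁻ y, ENNReal.ofReal (W y) ∂(κ x) ≤ ENNReal.ofReal (a * W x + m))
    (n : ℕ) (x : X) :
    ∫⁻ y, ENNReal.ofReal (W y) ∂((κ ^ n) x) ≤ ENNReal.ofReal (a ^ n * W x + m / (1 - a)) := by
  have hM : 0 ≤ m / (1 - a) := div_nonneg hm (by linarith)
  induction n with
  | zero =>
    rw [pow_zero, pow_zero, one_mul]
    change ∫⁻ y, ENNReal.ofReal (W y) ∂(Kernel.id x) ≤ _
    rw [Kernel.id_apply, lintegral_dirac' _ (by fun_prop)]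
    exact ENNReal.ofReal_le_ofReal (by linarith)
  | succ n ih =>
    rw [pow_succ' κ n]
    change ∫⁻ y, ENNReal.ofReal (W y) ∂((κ ∘ₖ (κ ^ n)) x) ≤ _
    rw [Kernel.lintegral_comp _ _ _ (by fun_prop)]
    refine (lintegral_mono hdrift).trans ?_
    rw [lintegral_ofReal_mul_add hWm hW ha hm]
    refine (add_le_add_left (mul_le_mul_right ih _) _).trans ?_
    have h0 : 0 ≤ a ^ n * W x + m / (1 - a) := add_nonneg (mul_nonneg (pow_nonneg ha n) (hW x)) hM
    rw [← ENNReal.ofReal_mul ha, ← ENNReal.ofReal_add (mul_nonneg ha h0) hm]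
    refine ENNReal.ofReal_le_ofReal (le_of_eq ?_)
    have : 1 - a ≠ 0 := by linarith
    field_simp
    ring

theorem integral_pow_succ {E : Type*} [NormedAddCommGroup E] [NormedSpace ℝ E]
    (κ : Kernel X X) [IsMarkovKernel κ] (n : ℕ) (x : X) {f : X → E}
    (hf : Integrable f ((κ ^ (n + 1)) x)) :
    ∫ y, f y ∂((κ ^ (n + 1)) x) = ∫ y, ∫ z, f z ∂((κ ^ n) y) ∂(κ x) := by
  rw [pow_succ] at hf ⊢
  exact Kernel.integral_comp (κ := κ) (η := κ ^ n) hf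

theorem integral_pow_add {E : Type*} [NormedAddCommGroup E] [NormedSpace ℝ E]
    (κ : Kernel X X) [IsMarkovKernel κ] (m n : ℕ) (x : X) {f : X → E}
    (hf : Integrable f ((κ ^ (m + n)) x)) :
    ∫ y, f y ∂((κ ^ (m + n)) x) = ∫ y, ∫ z, f z ∂((κ ^ m) y) ∂((κ ^ n) x) := by
  rw [pow_add] at hf ⊢
  exact Kernel.integral_comp (κ := κ ^ n) (η := κ ^ m) hf

theorem invariant_pow {κ : Kernel X X} {π : Measure X} (h : κ.Invariant π) (n : ℕ) :
    (κ ^ n).Invariant π := by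
  induction n with
  | zero => rw [pow_zero]; exact Measure.id_comp
  | succ n ih => rw [pow_succ]; exact ih.comp h

theorem integral_kernel_of_invariant {E : Type*} [NormedAddCommGroup E] [NormedSpace ℝ E]
    {κ : Kernel X X} [IsMarkovKernel κ] {π : Measure X} [SFinite π] (h : κ.Invariant π)
    {f : X → E} (hf : Integrable f π) : ∫ x, ∫ y, f y ∂(κ x) ∂π = ∫ x, f x ∂π := by
  have h1 : κ ∘ₘ π = π := h
  rw [Measure.comp_eq_comp_const_apply] at h1
  conv_rhs => rw [← h1]
  rw [← h1] at hf
  rw [Kernel.integral_comp hf, Kernel.const_apply]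

/-- The centre is the supremum of f - g, which the hypothesis places below every value of f + g.
This turns a weighted oscillation bound into a weighted sup bound after subtracting a constant. -/
theorem exists_sub_le_of_forall_sub_le {X : Type*} [Nonempty X] {f g : X → ℝ}
    (h : ∀ x y, f x - f y ≤ g x + g y) : ∃ c, ∀ x, |f x - c| ≤ g x := by
  obtain ⟨x₀⟩ := ‹Nonempty X›
  have hb : BddAbove (range fun x => f x - g x) := by
    refine ⟨f x₀ + g x₀, ?_⟩
    rintro _ ⟨x, rfl⟩
    linarith [h x x₀]
  refine ⟨⨆ x, (f x - g x), fun x => abs_le.2 ⟨?_, ?_⟩⟩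
  · have : Nonempty X := ⟨x₀⟩
    have := ciSup_le (f := fun x => f x - g x) (c := f x + g x) fun y => by linarith [h y x]
    linarith
  · have : f x - g x ≤ ⨆ x, (f x - g x) := le_ciSup hb x
    linarith

/-- One step of the contraction in Harris' theorem, for the seminorm
`sup |f x - f y| / (2 + β W x + β W y)`. -/
theorem abs_integral_sub_le_of_drift_of_small (κ : Kernel X X) [IsMarkovKernel κ] {W : X → ℝ}
    (hWm : Measurable W) (hW : ∀ x, 0 ≤ W x) {M : ℝ} (hM : 0 ≤ M)
    (hdrift : ∀ x, ∫⁻ y, ENNReal.ofReal (W y) ∂(κ x) ≤ ENNReal.ofReal (1 / 2 * W x + M))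
    (hsmall : ∀ x y, W x + W y ≤ 8 * M + 8 → ∀ f : X → ℝ, Measurable f → ∀ s, (∀ z, |f z| ≤ s) →
      |∫ z, f z ∂(κ x) - ∫ z, f z ∂(κ y)| ≤ s)
    {β : ℝ} (hβ : β = 1 / (12 * M + 8)) {f : X → ℝ} (hf : Measurable f) {s : ℝ} (hs : 0 ≤ s)
    (hfs : ∀ x y, |f x - f y| ≤ s * (2 + β * W x + β * W y)) (x y : X) :
    |∫ z, f z ∂(κ x) - ∫ z, f z ∂(κ y)| ≤ 15 / 16 * s * (2 + β * W x + β * W y) := by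
  have hβ0 : 0 < β := by rw [hβ]; positivity
  have hβM : β * (12 * M + 8) = 1 := by rw [hβ]; field_simp
  have hβM0 : 0 ≤ β * M := by positivity
  have hint : ∀ x, Integrable W (κ x) ∧ ∫ z, W z ∂(κ x) ≤ 1 / 2 * W x + M := fun x =>
    integrable_and_integral_le_of_lintegral_le hWm hW (by linarith [hW x]) (hdrift x)
  have hne : Nonempty X := ⟨x⟩
  obtain ⟨c, hc⟩ := exists_sub_le_of_forall_sub_le (f := f) (g := fun x => s * (1 + β * W x))
    fun x y => (le_abs_self _).trans ((hfs x y).trans (le_of_eq (by ring)))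
  set g : X → ℝ := fun z => f z - c with hg
  have hgm : Measurable g := hf.sub_const c
  have hgb : ∀ z, ‖g z‖ ≤ s + s * β * W z := fun z => (hc z).trans (le_of_eq (by ring))
  have hgi : ∀ x, Integrable g (κ x) := fun x =>
    integrable_of_norm_le_add_mul (hint x).1 hgm.stronglyMeasurable hgb
  have hfg : ∀ x, ∫ z, f z ∂(κ x) = ∫ z, g z ∂(κ x) + c := fun x => by
    have : f = fun z => g z + c := by ext z; simp [hg]
    rw [this, integral_add (hgi x) (integrable_const c)]
    simp
  rw [hfg, hfg, add_sub_add_right_eq_sub]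
  have hsβ : 0 ≤ s * β := by positivity
  have hWx := hW x
  have hWy := hW y
  rcases le_total (W x + W y) (8 * M + 8) with hxy | hxy
  -- Clip g at height s. The small-set condition gains a factor 2 on the clipped part over the
  -- trivial bound 2s; the remainder is at most sβW and is handled by the drift.
  · set g₁ : X → ℝ := fun z => max (-s) (min s (g z)) with hg₁
    have hg₁m : Measurable g₁ := measurable_const.max (measurable_const.min hgm)
    have hg₁b : ∀ z, |g₁ z| ≤ s := fun z =>
      abs_le.2 ⟨le_max_left _ _, max_le (by linarith) (min_le_left _ _)⟩
    have hg₁i : ∀ x, Integrable g₁ (κ x) := fun x =>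
      integrable_of_norm_le hg₁m.stronglyMeasurable hg₁b
    have hdiff : ∀ z, ‖g z - g₁ z‖ ≤ 0 + s * β * W z := fun z => by
      have h1 := hgb z
      have h2 : 0 ≤ s * β * W z := mul_nonneg hsβ (hW z)
      rw [Real.norm_eq_abs, abs_le] at h1 ⊢
      rcases le_total s (g z) with h | h
      · have : g₁ z = s := by simp only [hg₁]; rw [min_eq_left h, max_eq_right (by linarith)]
        constructor <;> linarith
      · rcases le_total (-s) (g z) with h' | h'
        · have : g₁ z = g z := by simp only [hg₁]; rw [min_eq_right h, max_eq_right h']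
          constructor <;> linarith
        · have : g₁ z = -s := by simp only [hg₁]; rw [min_eq_right h, max_eq_left h']
          constructor <;> linarith
    have hd : ∀ x, |∫ z, g z ∂(κ x) - ∫ z, g₁ z ∂(κ x)| ≤ 0 + s * β * (1 / 2 * W x + M) :=
      fun x => by
        rw [← integral_sub (hgi x) (hg₁i x)]
        exact norm_integral_le_add_mul (hint x).1 (hint x).2 hsβ hdiff
    have h1 := hsmall x y hxy g₁ hg₁m s hg₁b
    have h2 := hd x
    have h3 := hd y
    rw [abs_le] at h1 h2 h3 ⊢
    -- On this region the bracket is at most 6M + 4, and β is chosen so that β(6M + 4) = 1/2.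
    have key : s + s * β * (1 / 2 * (W x + W y) + 2 * M) ≤ s * (3 / 2) := by
      have : β * (1 / 2 * (W x + W y) + 2 * M) ≤ 1 / 2 := by nlinarith
      nlinarith
    have key2 : s * (3 / 2) ≤ 15 / 16 * s * (2 + β * W x + β * W y) := by
      have : 0 ≤ β * W x + β * W y := by positivity
      nlinarith
    constructor <;> linarith
  · have hb : ∀ x, |∫ z, g z ∂(κ x)| ≤ s + s * β * (1 / 2 * W x + M) := fun x =>
      norm_integral_le_add_mul (hint x).1 (hint x).2 hsβ hgb
    have h2 := hb x
    have h3 := hb y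
    -- With t = β(W x + W y), the drift leaves 2 + 3t/4, and this is at most (15/16)(2 + t) exactly
    -- when t ≥ 2/3. This fixes the rate 15/16.
    have ht : 2 / 3 ≤ β * (W x + W y) := by
      have : β * (8 * M + 8) ≤ β * (W x + W y) := by gcongr
      nlinarith
    have ht2 : 2 * (β * M) ≤ 1 / 4 * (β * (W x + W y)) := by nlinarith
    have key : 2 * s + s * β * (1 / 2 * (W x + W y) + 2 * M)
        ≤ 15 / 16 * s * (2 + β * W x + β * W y) := by
      have : 2 + β * (1 / 2 * (W x + W y) + 2 * M) ≤ 15 / 16 * (2 + β * (W x + W y)) := by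
        linarith
      have := mul_le_mul_of_nonneg_left this hs
      linarith
    rw [abs_le] at h2 h3 ⊢
    constructor <;> linarith

/-- Harris' theorem: geometric contraction of the powers of the kernel. -/
theorem abs_integral_pow_sub_le_of_drift_of_small (κ : Kernel X X) [IsMarkovKernel κ] {W : X → ℝ}
    (hWm : Measurable W) (hW : ∀ x, 0 ≤ W x) {M : ℝ} (hM : 0 ≤ M)
    (hdrift : ∀ x, ∫⁻ y, ENNReal.ofReal (W y) ∂(κ x) ≤ ENNReal.ofReal (1 / 2 * W x + M))
    (hsmall : ∀ x y, W x + W y ≤ 8 * M + 8 → ∀ f : X → ℝ, Measurable f → ∀ s, (∀ z, |f z| ≤ s) →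
      |∫ z, f z ∂(κ x) - ∫ z, f z ∂(κ y)| ≤ s)
    {β : ℝ} (hβ : β = 1 / (12 * M + 8)) (n : ℕ) {f : X → ℝ} (hf : Measurable f) {s : ℝ}
    (hs : 0 ≤ s) (hfs : ∀ x y, |f x - f y| ≤ s * (2 + β * W x + β * W y)) (x y : X) :
    |∫ z, f z ∂((κ ^ n) x) - ∫ z, f z ∂((κ ^ n) y)|
      ≤ (15 / 16) ^ n * s * (2 + β * W x + β * W y) := by
  induction n generalizing f s with
  | zero =>
    simp only [pow_zero, one_mul]
    change |∫ z, f z ∂(Kernel.id x) - ∫ z, f z ∂(Kernel.id y)| ≤ _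
    rw [Kernel.id_apply, Kernel.id_apply, integral_dirac' _ _ hf.stronglyMeasurable,
      integral_dirac' _ _ hf.stronglyMeasurable]
    exact hfs x y
  | succ n ih =>
    have hβ0 : 0 < β := by rw [hβ]; positivity
    have hint : ∀ z, Integrable f ((κ ^ (n + 1)) z) := fun z => by
      have h := integrable_and_integral_le_of_lintegral_le hWm hW
        (add_nonneg (mul_nonneg (by positivity) (hW z)) (div_nonneg hM (by norm_num)))
        (lintegral_pow_le_of_drift κ hWm hW (by norm_num) (by norm_num) hM hdrift (n + 1) z)
      refine integrable_of_norm_le_add_mul (a := |f z| + s * (2 + β * W z)) (b := s * β) h.1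
        hf.stronglyMeasurable fun w => ?_
      have := hfs w z
      have h3 := abs_sub_abs_le_abs_sub (f w) (f z)
      rw [Real.norm_eq_abs]
      linarith
    have hcomp : ∀ z, ∫ w, f w ∂((κ ^ (n + 1)) z) = ∫ w, ∫ v, f v ∂(κ w) ∂((κ ^ n) z) :=
      fun z => by
        have := hint z
        rw [add_comm] at this ⊢
        rw [integral_pow_add κ 1 n z this, pow_one]
    rw [hcomp, hcomp]
    refine (ih (f := fun w => ∫ v, f v ∂(κ w)) (s := 15 / 16 * s)
      (hf.stronglyMeasurable.integral_kernel).measurable (by positivity)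
      (abs_integral_sub_le_of_drift_of_small κ hWm hW hM hdrift hsmall hβ hf hs hfs)).trans
      (le_of_eq ?_)
    ring

end Kernel

/-! ### The noise law and its smoothing effect. -/

/-- `ν` is a Lebesgue probability density with a first moment. -/
structure IsNoiseDensity (ν : ℝ → ℝ) : Prop where
  measurable : Measurable ν
  nonneg : ∀ y, 0 ≤ ν y
  integral_eq_one : ∫ y, ν y = 1
  integrable_moment : Integrable fun y => |y| * ν y

namespace IsNoiseDensity

variable {ν : ℝ → ℝ} (h : IsNoiseDensity ν)
include h

theorem integrable : Integrable ν := by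
  -- A non-integrable function has integral 0 by convention, which contradicts total mass one.
  by_contra hn
  have := h.integral_eq_one
  rw [integral_undef hn] at this
  exact zero_ne_one this

theorem isProbabilityMeasure : IsProbabilityMeasure (noiseLaw ν) := by
  constructor
  rw [noiseLaw, withDensity_apply _ MeasurableSet.univ, Measure.restrict_univ,
    ← ofReal_integral_eq_lintegral_ofReal h.integrable (ae_of_all _ h.nonneg),
    h.integral_eq_one, ENNReal.ofReal_one]

theorem isMarkovKernel (α : ℝ) : IsMarkovKernel (arKernel ν α) := by
  have := h.isProbabilityMeasure
  refine ⟨fun x => ?_⟩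
  change IsProbabilityMeasure ((noiseLaw ν).map fun y => α * x + y)
  exact Measure.isProbabilityMeasure_map (by fun_prop)

theorem moment_nonneg : 0 ≤ ∫ y, |y| * ν y :=
  integral_nonneg fun y => mul_nonneg (abs_nonneg y) (h.nonneg y)

theorem lintegral_abs :
    ∫⁻ y, ENNReal.ofReal |y| ∂(noiseLaw ν) = ENNReal.ofReal (∫ y, |y| * ν y) := by
  have hm := h.measurable
  rw [noiseLaw, lintegral_withDensity_eq_lintegral_mul _ (by fun_prop) (by fun_prop),
    ofReal_integral_eq_lintegral_ofReal h.integrable_moment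
      (ae_of_all _ fun y => mul_nonneg (abs_nonneg y) (h.nonneg y))]
  refine lintegral_congr fun y => ?_
  rw [Pi.mul_apply, ENNReal.ofReal_mul (abs_nonneg y), mul_comm]

theorem integral_noiseLaw {E : Type*} [NormedAddCommGroup E] [NormedSpace ℝ E] (g : ℝ → E) :
    ∫ y, g y ∂(noiseLaw ν) = ∫ y, ν y • g y := by
  have hm := h.measurable
  rw [noiseLaw, integral_withDensity_eq_integral_toReal_smul (by fun_prop)
    (ae_of_all _ fun _ => ENNReal.ofReal_lt_top)]
  simp only [ENNReal.toReal_ofReal (h.nonneg _)]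

theorem tendsto_integral_abs_translate_sub :
    Tendsto (fun t => ∫ y, |ν (y + t) - ν y|) (𝓝 0) (𝓝 0) := by
  have hi := h.integrable
  set F : Lp ℝ 1 (volume : Measure ℝ) := hi.toL1 ν
  let g : ℝ → C(ℝ, ℝ) := fun t => ⟨fun y => y + t, by fun_prop⟩
  have hg : Continuous g := ContinuousMap.continuous_of_continuous_uncurry _
    (by simp only [g, Function.uncurry_def, ContinuousMap.coe_mk]; fun_prop)
  have hgm : ∀ t, MeasurePreserving (g t) (volume : Measure ℝ) volume := fun t =>
    measurePreserving_add_right volume t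
  have hc : Continuous fun t => Lp.compMeasurePreserving (g t) (hgm t) F :=
    continuous_const.compMeasurePreservingLp hg hgm ENNReal.one_ne_top
  have hd := (hc.dist (continuous_const (y := F))).tendsto 0
  have hz : ∀ t, dist (Lp.compMeasurePreserving (g t) (hgm t) F) F
      = ∫ y, |ν (y + t) - ν y| := fun t => by
    rw [L1.dist_eq_integral_dist]
    refine integral_congr_ae ?_
    have h1 := Lp.coeFn_compMeasurePreserving F (hgm t)
    have h2 : F =ᵐ[volume] ν := hi.coeFn_toL1
    have h3 := (hgm t).quasiMeasurePreserving.ae_eq_comp h2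
    filter_upwards [h1, h2, h3] with y hy1 hy2 hy3
    rw [hy1, hy2, Real.dist_eq, hy3]
    rfl
  simp only [hz] at hd
  simpa using hd

/-- A change of variables moves the translation from f onto the density, so f needs no regularity.
-/
theorem norm_integral_translate_sub_le {f : ℝ → ℂ} (hf : Measurable f) (hf1 : ∀ x, ‖f x‖ ≤ 1)
    (z z' : ℝ) : ‖∫ y, f (z + y) ∂(noiseLaw ν) - ∫ y, f (z' + y) ∂(noiseLaw ν)‖
      ≤ ∫ y, |ν (y + (z' - z)) - ν y| := by
  have hi := h.integrable
  have key : ∀ z, ∫ y, f (z + y) ∂(noiseLaw ν) = ∫ y, ν (y - z) • f y := fun z => by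
    rw [h.integral_noiseLaw, ← integral_add_left_eq_self (fun y => ν (y - z) • f y) z]
    simp only [add_sub_cancel_left]
  have hint : ∀ z, Integrable fun y => ν (y - z) • f y := fun z =>
    (hi.comp_sub_right z).smul_bdd 1 hf.aestronglyMeasurable (ae_of_all _ hf1)
  rw [key, key, ← integral_sub (hint z) (hint z'),
    ← integral_sub_right_eq_self (fun y => |ν (y + (z' - z)) - ν y|) z']
  refine norm_integral_le_of_norm_le ?_ (ae_of_all _ fun y => ?_)
  · have := ((hi.comp_sub_right z).sub (hi.comp_sub_right z')).abs
    refine this.congr (ae_of_all _ fun y => ?_)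
    simp
  · rw [← sub_smul, norm_smul, Real.norm_eq_abs]
    have : y - z' + (z' - z) = y - z := by ring
    rw [this]
    exact mul_le_of_le_one_right (abs_nonneg _) (hf1 y)

theorem exists_norm_integral_translate_sub_le {ε : ℝ} (hε : 0 < ε) :
    ∃ K : ℝ, 0 ≤ K ∧ ∀ f : ℝ → ℂ, Measurable f → (∀ x, ‖f x‖ ≤ 1) → ∀ z z' : ℝ,
      ‖∫ y, f (z + y) ∂(noiseLaw ν) - ∫ y, f (z' + y) ∂(noiseLaw ν)‖ ≤ ε + K * |z - z'| := by
  have := h.isProbabilityMeasure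
  obtain ⟨δ, hδ, hδε⟩ := Metric.tendsto_nhds_nhds.1 h.tendsto_integral_abs_translate_sub ε hε
  -- For shifts below δ the L¹ modulus is under ε; beyond δ the trivial bound 2 is at most (2/δ)|z -
  -- z'|.
  refine ⟨2 / δ, by positivity, fun f hf hf1 z z' => ?_⟩
  rcases lt_or_ge |z - z'| δ with hz | hz
  · refine (h.norm_integral_translate_sub_le hf hf1 z z').trans ?_
    have h1 := hδε (x := z' - z) (by rwa [Real.dist_eq, sub_zero, abs_sub_comm])
    rw [Real.dist_eq, sub_zero] at h1
    have h2 : 0 ≤ 2 / δ * |z - z'| := by positivity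
    linarith [le_abs_self (∫ y, |ν (y + (z' - z)) - ν y|)]
  · have h1 : ∀ z, ‖∫ y, f (z + y) ∂(noiseLaw ν)‖ ≤ 1 := fun z =>
      norm_integral_le_of_forall_norm_le fun y => hf1 _
    have h2 : 2 ≤ 2 / δ * |z - z'| := by
      calc (2 : ℝ) = 2 / δ * δ := by field_simp
        _ ≤ _ := by gcongr
    linarith [norm_sub_le (∫ y, f (z + y) ∂(noiseLaw ν)) (∫ y, f (z' + y) ∂(noiseLaw ν)),
      h1 z, h1 z']

end IsNoiseDensity

/-! ### Moments and smoothing for powers of the autoregressive kernel. -/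

theorem integral_arKernel {E : Type*} [NormedAddCommGroup E] [NormedSpace ℝ E] (ν : ℝ → ℝ)
    (α x : ℝ) {f : ℝ → E} (hf : StronglyMeasurable f) :
    ∫ y, f y ∂(arKernel ν α x) = ∫ y, f (α * x + y) ∂(noiseLaw ν) :=
  integral_map (by fun_prop) hf.aestronglyMeasurable

theorem lintegral_arKernel (ν : ℝ → ℝ) (α x : ℝ) {f : ℝ → ℝ≥0∞} (hf : Measurable f) :
    ∫⁻ y, f y ∂(arKernel ν α x) = ∫⁻ y, f (α * x + y) ∂(noiseLaw ν) :=
  lintegral_map hf (by fun_prop)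

namespace IsNoiseDensity

variable {ν : ℝ → ℝ} (h : IsNoiseDensity ν)
include h

theorem lintegral_abs_arKernel_le (α x : ℝ) :
    ∫⁻ y, ENNReal.ofReal |y| ∂(arKernel ν α x)
      ≤ ENNReal.ofReal (|α| * |x| + ∫ y, |y| * ν y) := by
  have := h.isProbabilityMeasure
  rw [lintegral_arKernel ν α x (by fun_prop), ENNReal.ofReal_add (by positivity) h.moment_nonneg,
    ← h.lintegral_abs]
  calc ∫⁻ y, ENNReal.ofReal |α * x + y| ∂(noiseLaw ν)
      ≤ ∫⁻ y, (ENNReal.ofReal (|α| * |x|) + ENNReal.ofReal |y|) ∂(noiseLaw ν) := by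
        refine lintegral_mono fun y => ?_
        rw [← ENNReal.ofReal_add (by positivity) (abs_nonneg y), ← abs_mul]
        exact ENNReal.ofReal_le_ofReal (abs_add_le _ _)
    _ = _ := by
        rw [lintegral_add_left measurable_const]
        simp

theorem lintegral_arWeight_arKernel_le (α x : ℝ) :
    ∫⁻ y, ENNReal.ofReal (arWeight y) ∂(arKernel ν α x)
      ≤ ENNReal.ofReal (1 + |α| * |x| + ∫ y, |y| * ν y) := by
  have := h.isMarkovKernel α
  have h1 := lintegral_ofReal_mul_add (μ := arKernel ν α x) (W := fun y => |y|) (a := 1) (b := 1)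
    (by fun_prop) (fun y => abs_nonneg y) zero_le_one zero_le_one
  have h2 : ∀ y, arWeight y = 1 * |y| + 1 := fun y => by rw [arWeight]; ring
  simp only [h2]
  have h3 := h.lintegral_abs_arKernel_le α x
  rw [h1, ENNReal.ofReal_one, one_mul]
  refine (add_le_add_left h3 1).trans ?_
  rw [← ENNReal.ofReal_one, ← ENNReal.ofReal_add (add_nonneg (by positivity) h.moment_nonneg)
    zero_le_one]
  exact ENNReal.ofReal_le_ofReal (by linarith)

theorem lintegral_abs_arKernel_pow_le {α : ℝ} (hα : |α| < 1) (n : ℕ) (x : ℝ) :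
    ∫⁻ y, ENNReal.ofReal |y| ∂((arKernel ν α ^ n) x)
      ≤ ENNReal.ofReal (|α| ^ n * |x| + (∫ y, |y| * ν y) / (1 - |α|)) :=
  have := h.isMarkovKernel α
  lintegral_pow_le_of_drift _ (by fun_prop) (fun y => abs_nonneg y) (abs_nonneg α) hα
    h.moment_nonneg (h.lintegral_abs_arKernel_le α) n x

theorem integrable_abs_arKernel_pow {α : ℝ} (hα : |α| < 1) (n : ℕ) (x : ℝ) :
    Integrable (fun y => |y|) ((arKernel ν α ^ n) x) ∧ ∫ y, |y| ∂((arKernel ν α ^ n) x)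
      ≤ |α| ^ n * |x| + (∫ y, |y| * ν y) / (1 - |α|) :=
  integrable_and_integral_le_of_lintegral_le (by fun_prop) (fun y => abs_nonneg y)
    (add_nonneg (by positivity) (div_nonneg h.moment_nonneg (by linarith)))
    (h.lintegral_abs_arKernel_pow_le hα n x)

/-- Conditioning on a common first noise reduces n + 1 steps to n steps from points whose distance
is multiplied by |α|. Smoothing is used only at the last step, so ε does not accumulate. -/
theorem norm_integral_arKernel_pow_sub_le (α : ℝ) {ε K : ℝ}
    (hK : ∀ f : ℝ → ℂ, Measurable f → (∀ x, ‖f x‖ ≤ 1) → ∀ z z' : ℝ,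
      ‖∫ y, f (z + y) ∂(noiseLaw ν) - ∫ y, f (z' + y) ∂(noiseLaw ν)‖ ≤ ε + K * |z - z'|)
    (n : ℕ) {f : ℝ → ℂ} (hf : Measurable f) (hf1 : ∀ x, ‖f x‖ ≤ 1) (x x' : ℝ) :
    ‖∫ y, f y ∂((arKernel ν α ^ (n + 1)) x) - ∫ y, f y ∂((arKernel ν α ^ (n + 1)) x')‖
      ≤ ε + K * (|α| ^ (n + 1) * |x - x'|) := by
  have := h.isMarkovKernel α
  have := h.isProbabilityMeasure
  induction n generalizing x x' with
  | zero =>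
    simp only [zero_add, pow_one]
    rw [integral_arKernel ν α x hf.stronglyMeasurable,
      integral_arKernel ν α x' hf.stronglyMeasurable, ← abs_mul, mul_sub]
    exact hK f hf hf1 _ _
  | succ n ih =>
    have hF : StronglyMeasurable fun y => ∫ z, f z ∂((arKernel ν α ^ (n + 1)) y) :=
      hf.stronglyMeasurable.integral_kernel
    have hFb : ∀ y, ‖∫ z, f z ∂((arKernel ν α ^ (n + 1)) y)‖ ≤ 1 := fun y =>
      norm_integral_le_of_forall_norm_le hf1
    have hcomp : ∀ x, ∫ y, f y ∂((arKernel ν α ^ (n + 1 + 1)) x)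
        = ∫ y, ∫ z, f z ∂((arKernel ν α ^ (n + 1)) (α * x + y)) ∂(noiseLaw ν) := fun x => by
      rw [integral_pow_succ _ _ _ (integrable_of_norm_le hf.stronglyMeasurable hf1),
        integral_arKernel ν α x hF]
    have hFi : ∀ x, Integrable
        (fun y => ∫ z, f z ∂((arKernel ν α ^ (n + 1)) (α * x + y))) (noiseLaw ν) := fun x =>
      integrable_of_norm_le (hF.comp_measurable (by fun_prop)) fun y => hFb _
    rw [hcomp, hcomp, ← integral_sub (hFi x) (hFi x')]
    refine norm_integral_le_of_forall_norm_le fun y => (ih _ _).trans (le_of_eq ?_)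
    rw [add_sub_add_right_eq_sub, ← mul_sub, abs_mul]
    ring

end IsNoiseDensity

/-- Multiplying f by a unimodular constant makes the difference of integrals real and nonnegative;
its real part is then an admissible real test function, so no constant is lost. -/
theorem norm_integral_sub_integral_le_of_real {X : Type*} [MeasurableSpace X] {μ μ' : Measure X}
    {V : X → ℝ} {B : ℝ} (hB : ∀ g : X → ℝ, Measurable g → (∀ x, |g x| ≤ V x) →
      |∫ x, g x ∂μ - ∫ x, g x ∂μ'| ≤ B) {f : X → ℂ} (hf : Measurable f) (hfV : ∀ x, ‖f x‖ ≤ V x)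
    (hi : Integrable f μ) (hi' : Integrable f μ') :
    ‖∫ x, f x ∂μ - ∫ x, f x ∂μ'‖ ≤ B := by
  set z : ℂ := ∫ x, f x ∂μ - ∫ x, f x ∂μ' with hz
  rcases eq_or_ne z 0 with h0 | h0
  · rw [h0, norm_zero]
    refine (abs_nonneg _).trans (hB (fun _ => 0) measurable_const fun x => ?_)
    rw [abs_zero]
    exact (norm_nonneg _).trans (hfV x)
  set u : ℂ := (starRingEnd ℂ) z / ‖z‖ with hu
  have hzn : (‖z‖ : ℂ) ≠ 0 := by simpa using h0
  have hu1 : ‖u‖ = 1 := by simp [hu, h0]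
  have huz : u * z = ‖z‖ := by
    rw [hu, div_mul_eq_mul_div, mul_comm, Complex.mul_conj', sq, mul_div_assoc, div_self hzn,
      mul_one]
  have hre : ∀ {ρ : Measure X}, Integrable f ρ → ∫ x, (u * f x).re ∂ρ = (u * ∫ x, f x ∂ρ).re :=
    fun {ρ} h => by
      rw [← integral_const_mul]
      exact Complex.reCLM.integral_comp_comm (h.const_mul u)
  have := hB (fun x => (u * f x).re) (Complex.measurable_re.comp (hf.const_mul u)) fun x => by
    refine (Complex.abs_re_le_norm _).trans ?_
    rw [norm_mul, hu1, one_mul]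
    exact hfV x
  rw [hre hi, hre hi', ← Complex.sub_re, ← mul_sub, ← hz, huz, Complex.ofReal_re,
    abs_of_nonneg (norm_nonneg z)] at this
  exact this

/-! ### Forgetting the initial state, the invariant law and geometric ergodicity. -/

namespace IsNoiseDensity

variable {ν : ℝ → ℝ} (h : IsNoiseDensity ν)
include h

theorem exists_abs_integral_arKernel_pow_sub_le (α : ℝ) {ε : ℝ} (hε : 0 < ε) :
    ∃ K : ℝ, 0 ≤ K ∧ ∀ (n : ℕ) (f : ℝ → ℝ), Measurable f → ∀ s, (∀ x, |f x| ≤ s) → ∀ x x' : ℝ,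
      |∫ y, f y ∂((arKernel ν α ^ (n + 1)) x) - ∫ y, f y ∂((arKernel ν α ^ (n + 1)) x')|
        ≤ s * (ε + K * (|α| ^ (n + 1) * |x - x'|)) := by
  obtain ⟨K, hK0, hK⟩ := h.exists_norm_integral_translate_sub_le hε
  refine ⟨K, hK0, fun n f hf s hs x x' => ?_⟩
  have hs0 : 0 ≤ s := (abs_nonneg _).trans (hs 0)
  rcases hs0.eq_or_lt with rfl | hs0
  · have : ∀ x, f x = 0 := fun x => abs_nonpos_iff.1 (hs x)
    simp [this]
  have key := h.norm_integral_arKernel_pow_sub_le α hK n (f := fun x => ((f x / s : ℝ) : ℂ))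
    (Complex.measurable_ofReal.comp (hf.div_const s)) (fun x => by
      rw [Complex.norm_real, Real.norm_eq_abs, abs_div, abs_of_pos hs0]
      exact (div_le_one hs0).2 (hs x)) x x'
  rw [integral_complex_ofReal, integral_complex_ofReal, ← Complex.ofReal_sub, Complex.norm_real,
    integral_div, integral_div, ← sub_div, Real.norm_eq_abs, abs_div, abs_of_pos hs0,
    div_le_iff₀ hs0] at key
  rwa [mul_comm s]

theorem tendsto_integral_arKernel_pow_sub {α : ℝ} (hα : |α| < 1) {f : ℝ → ℝ} (hf : Measurable f)
    {s : ℝ} (hs : ∀ x, |f x| ≤ s) (x x' : ℝ) :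
    Tendsto (fun n => ∫ y, f y ∂((arKernel ν α ^ n) x) - ∫ y, f y ∂((arKernel ν α ^ n) x'))
      atTop (𝓝 0) := by
  rw [← tendsto_add_atTop_iff_nat 1, Metric.tendsto_atTop]
  intro ε hε
  have hs0 : 0 ≤ s := (abs_nonneg _).trans (hs 0)
  obtain ⟨K, hK0, hK⟩ := h.exists_abs_integral_arKernel_pow_sub_le α
    (show 0 < ε / (2 * (s + 1)) by positivity)
  have hlim : Tendsto (fun n => s * (ε / (2 * (s + 1)) + K * (|α| ^ (n + 1) * |x - x'|))) atTop
      (𝓝 (s * (ε / (2 * (s + 1)) + K * (0 * |x - x'|)))) :=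
    ((((((tendsto_pow_atTop_nhds_zero_of_lt_one (abs_nonneg α) hα).comp
      (tendsto_add_atTop_nat 1)).mul_const _).const_mul K).const_add _).const_mul s)
  have hlt : s * (ε / (2 * (s + 1)) + K * (0 * |x - x'|)) < ε := by
    rw [zero_mul, mul_zero, add_zero, mul_div_assoc', div_lt_iff₀ (by positivity)]
    nlinarith
  obtain ⟨N, hN⟩ := eventually_atTop.1 (hlim.eventually (gt_mem_nhds hlt))
  refine ⟨N, fun n hn => ?_⟩
  rw [Real.dist_eq, sub_zero]
  exact (hK n f hf s hs x x').trans_lt (hN n hn)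

theorem tendsto_integral_integral_arKernel_pow_sub {α : ℝ} (hα : |α| < 1) {f : ℝ → ℝ}
    (hf : Measurable f) {s : ℝ} (hs : ∀ x, |f x| ≤ s) (ρ : Measure ℝ) [IsProbabilityMeasure ρ] :
    Tendsto (fun n => ∫ x, ∫ y, f y ∂((arKernel ν α ^ n) x) ∂ρ
      - ∫ y, f y ∂((arKernel ν α ^ n) 0)) atTop (𝓝 0) := by
  have := h.isMarkovKernel α
  have hb : ∀ n x, ‖∫ y, f y ∂((arKernel ν α ^ n) x)‖ ≤ s := fun n x =>
    norm_integral_le_of_forall_norm_le hs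
  have hm : ∀ n, StronglyMeasurable fun x => ∫ y, f y ∂((arKernel ν α ^ n) x) := fun n =>
    hf.stronglyMeasurable.integral_kernel
  have hlim := tendsto_integral_of_dominated_convergence (μ := ρ) (fun _ => 2 * s)
    (F := fun n x => ∫ y, f y ∂((arKernel ν α ^ n) x) - ∫ y, f y ∂((arKernel ν α ^ n) 0))
    (f := fun _ => 0) (fun n => ((hm n).sub stronglyMeasurable_const).aestronglyMeasurable)
    (integrable_const _)
    (fun n => ae_of_all _ fun x => (norm_sub_le _ _).trans (by linarith [hb n x, hb n 0]))
    (ae_of_all _ fun x => h.tendsto_integral_arKernel_pow_sub hα hf hs x 0)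
  rw [integral_zero] at hlim
  refine hlim.congr fun n => ?_
  rw [integral_sub (integrable_of_norm_le (hm n) (hb n)) (integrable_const _)]
  simp

theorem tendsto_integral_arKernel_pow_of_invariant {α : ℝ} (hα : |α| < 1) {π : Measure ℝ}
    [IsProbabilityMeasure π] (hπ : (arKernel ν α).Invariant π) {f : ℝ → ℝ} (hf : Measurable f)
    {s : ℝ} (hs : ∀ x, |f x| ≤ s) :
    Tendsto (fun n => ∫ y, f y ∂((arKernel ν α ^ n) 0)) atTop (𝓝 (∫ x, f x ∂π)) := by
  have := h.isMarkovKernel α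
  have hlim := (h.tendsto_integral_integral_arKernel_pow_sub hα hf hs π).const_sub (∫ x, f x ∂π)
  rw [sub_zero] at hlim
  refine hlim.congr fun n => ?_
  rw [integral_kernel_of_invariant (invariant_pow hπ n)
    (integrable_of_norm_le hf.stronglyMeasurable hs), sub_sub_cancel]

/-- Both invariant laws give a bounded test function the same integral, namely the limit of its
means under the chain started at 0. -/
theorem invariant_unique {α : ℝ} (hα : |α| < 1) {π π' : Measure ℝ} [IsProbabilityMeasure π]
    [IsProbabilityMeasure π'] (hπ : (arKernel ν α).Invariant π)
    (hπ' : (arKernel ν α).Invariant π') : π' = π :=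
  ext_of_forall_integral_eq_of_IsFiniteMeasure fun f =>
    tendsto_nhds_unique
      (h.tendsto_integral_arKernel_pow_of_invariant hα hπ' f.continuous.measurable f.norm_coe_le_norm)
      (h.tendsto_integral_arKernel_pow_of_invariant hα hπ f.continuous.measurable f.norm_coe_le_norm)

theorem continuous_integral_arKernel (α : ℝ) (f : BoundedContinuousFunction ℝ ℝ) :
    Continuous fun x => ∫ y, f y ∂(arKernel ν α x) := by
  have := h.isProbabilityMeasure
  simp only [integral_arKernel ν α _ f.continuous.stronglyMeasurable]
  refine continuous_of_dominated (bound := fun _ => ‖f‖) (fun x => ?_)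
    (fun x => ae_of_all _ fun y => f.norm_coe_le_norm _) (integrable_const _)
    (ae_of_all _ fun y => ?_)
  · exact (f.continuous.comp (by fun_prop)).aestronglyMeasurable
  · exact f.continuous.comp (by fun_prop)

theorem isTightMeasureSet_arKernel_pow {α : ℝ} (hα : |α| < 1) :
    IsTightMeasureSet (range fun n => (arKernel ν α ^ n) 0) := by
  set M : ℝ := (∫ y, |y| * ν y) / (1 - |α|)
  refine isTightMeasureSet_of_tendsto_measure_norm_gt ?_
  have hlim : Tendsto (fun r : ℝ => ENNReal.ofReal (M / r)) atTop (𝓝 0) := by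
    rw [← ENNReal.ofReal_zero]
    exact ENNReal.tendsto_ofReal (tendsto_const_nhds.div_atTop tendsto_id)
  refine tendsto_of_tendsto_of_tendsto_of_le_of_le' tendsto_const_nhds hlim
    (Eventually.of_forall fun _ => zero_le) ?_
  filter_upwards [eventually_gt_atTop 0] with r hr
  refine iSup₂_le ?_
  rintro _ ⟨n, rfl⟩
  have h1 := h.lintegral_abs_arKernel_pow_le hα n 0
  rw [abs_zero, mul_zero, zero_add] at h1
  calc (arKernel ν α ^ n) 0 {x | r < ‖x‖}
      ≤ (arKernel ν α ^ n) 0 {x | ENNReal.ofReal r ≤ ENNReal.ofReal |x|} :=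
        measure_mono fun x hx => ENNReal.ofReal_le_ofReal (le_of_lt hx)
    _ ≤ (∫⁻ x, ENNReal.ofReal |x| ∂((arKernel ν α ^ n) 0)) / ENNReal.ofReal r :=
        meas_ge_le_lintegral_div (by fun_prop) (by simpa using hr) ENNReal.ofReal_ne_top
    _ ≤ ENNReal.ofReal M / ENNReal.ofReal r := by gcongr
    _ = _ := (ENNReal.ofReal_div_of_pos hr).symm

/-- A weak limit point of the laws of the chain started at 0, obtained from Prokhorov's theorem.
Forgetting makes consecutive laws merge, so no Cesàro averages are needed. -/
theorem exists_invariant {α : ℝ} (hα : |α| < 1) :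
    ∃ π : Measure ℝ, IsProbabilityMeasure π ∧ (arKernel ν α).Invariant π ∧
      ∫⁻ x, ENNReal.ofReal |x| ∂π ≤ ENNReal.ofReal ((∫ y, |y| * ν y) / (1 - |α|)) := by
  have := h.isMarkovKernel α
  let μ : ℕ → ProbabilityMeasure ℝ := fun n => ⟨(arKernel ν α ^ n) 0, inferInstance⟩
  have htight : IsTightMeasureSet {((ρ : ProbabilityMeasure ℝ) : Measure ℝ) | ρ ∈ range μ} := by
    refine (h.isTightMeasureSet_arKernel_pow hα).subset ?_
    rintro _ ⟨_, ⟨n, rfl⟩, rfl⟩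
    exact ⟨n, rfl⟩
  obtain ⟨π, -, φ, hφ, hlim⟩ := (isCompact_closure_of_isTightMeasureSet htight).tendsto_subseq
    fun n => subset_closure (mem_range_self n)
  refine ⟨π, inferInstance, ?_, ?_⟩
  · have hbind : IsProbabilityMeasure (arKernel ν α ∘ₘ (π : Measure ℝ)) := inferInstance
    change arKernel ν α ∘ₘ (π : Measure ℝ) = π
    refine ext_of_forall_integral_eq_of_IsFiniteMeasure fun f => ?_
    have hfm := f.continuous.stronglyMeasurable
    have hf := f.norm_coe_le_norm
    have hPf : ∀ x, ‖∫ y, f y ∂(arKernel ν α x)‖ ≤ ‖f‖ := fun x =>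
      norm_integral_le_of_forall_norm_le hf
    let g : BoundedContinuousFunction ℝ ℝ := BoundedContinuousFunction.ofNormedAddCommGroup
      (fun x => ∫ y, f y ∂(arKernel ν α x)) (h.continuous_integral_arKernel α f) ‖f‖ hPf
    have h1 := ProbabilityMeasure.tendsto_iff_forall_integral_tendsto.1 hlim f
    have h2 := ProbabilityMeasure.tendsto_iff_forall_integral_tendsto.1 hlim g
    have h3 : Tendsto (fun k => ∫ x, g x ∂(μ (φ k) : Measure ℝ)
        - ∫ x, f x ∂(μ (φ k) : Measure ℝ)) atTop (𝓝 0) := by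
      -- Starting from P(0,·) instead of 0 amounts to one extra step, so forgetting compares step n
      -- + 1 with step n.
      refine ((h.tendsto_integral_integral_arKernel_pow_sub hα f.continuous.measurable hf
        (arKernel ν α 0)).comp hφ.tendsto_atTop).congr fun k => ?_
      have hfi : Integrable f ((arKernel ν α ^ (1 + φ k)) 0) := integrable_of_norm_le hfm hf
      have e1 := integral_pow_add (arKernel ν α) 1 (φ k) 0 hfi
      rw [add_comm] at hfi
      rw [add_comm, integral_pow_succ (arKernel ν α) (φ k) 0 hfi, pow_one] at e1
      simp only [Function.comp_apply]
      rw [e1]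
      rfl
    have h4 := tendsto_nhds_unique (h2.sub h1) h3
    have h5 : Integrable f (arKernel ν α ∘ₘ (π : Measure ℝ)) := integrable_of_norm_le hfm hf
    rw [Measure.comp_eq_comp_const_apply] at h5 ⊢
    rw [Kernel.integral_comp h5, Kernel.const_apply]
    exact sub_eq_zero.1 h4
  -- The first moment is lower semicontinuous under weak convergence, and the bound along the chain
  -- from 0 is uniform in n.
  · refine (lintegral_le_liminf_lintegral_of_forall_isOpen_measure_le_liminf_measure
      continuous_abs (fun x => abs_nonneg x)
      fun G hG => ProbabilityMeasure.le_liminf_measure_open_of_tendsto hlim hG).trans ?_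
    refine liminf_le_of_le (by isBoundedDefault) fun b hb => ?_
    obtain ⟨k, hk⟩ := hb.exists
    refine hk.trans ?_
    have := h.lintegral_abs_arKernel_pow_le hα (φ k) 0
    rwa [abs_zero, mul_zero, zero_add] at this

theorem exists_pow_forall_abs_integral_sub_le {α : ℝ} (hα : |α| < 1) (R : ℝ) :
    ∃ m : ℕ, m ≠ 0 ∧ |α| ^ m ≤ 1 / 2 ∧ ∀ x y : ℝ, |x| + |y| ≤ R → ∀ f : ℝ → ℝ, Measurable f →
      ∀ s, (∀ z, |f z| ≤ s) →
        |∫ z, f z ∂((arKernel ν α ^ m) x) - ∫ z, f z ∂((arKernel ν α ^ m) y)| ≤ s := by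
  obtain ⟨K, hK0, hK⟩ := h.exists_abs_integral_arKernel_pow_sub_le α (one_half_pos (α := ℝ))
  have hlim := (tendsto_pow_atTop_nhds_zero_of_lt_one (abs_nonneg α) hα).comp
    (tendsto_add_atTop_nat 1)
  have hlim2 := (hlim.mul_const R).const_mul K
  rw [zero_mul, mul_zero] at hlim2
  obtain ⟨n, hn1, hn2⟩ := ((hlim.eventually (ge_mem_nhds one_half_pos)).and
    (hlim2.eventually (ge_mem_nhds one_half_pos))).exists
  refine ⟨n + 1, n.succ_ne_zero, hn1, fun x y hxy f hf s hs => (hK n f hf s hs x y).trans ?_⟩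
  have hs0 : 0 ≤ s := (abs_nonneg _).trans (hs 0)
  have hd : |x - y| ≤ R := (abs_sub x y).trans hxy
  have : K * (|α| ^ (n + 1) * |x - y|) ≤ K * (|α| ^ (n + 1) * R) := by gcongr
  have : K * (|α| ^ (n + 1) * R) ≤ 1 / 2 := hn2
  exact mul_le_of_le_one_right hs0 (by linarith)

theorem exists_abs_integral_arKernel_pow_sub_integral_le {α : ℝ} (hα : |α| < 1) {π : Measure ℝ}
    [IsProbabilityMeasure π] (hπ : (arKernel ν α).Invariant π)
    (hπi : Integrable (fun x => |x|) π) :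
    ∃ c κ : ℝ, 0 < c ∧ 0 < κ ∧ κ < 1 ∧ ∀ (n : ℕ) (x : ℝ) (f : ℝ → ℝ), Measurable f →
      (∀ y, |f y| ≤ arWeight y) →
        |∫ y, f y ∂((arKernel ν α ^ n) x) - ∫ y, f y ∂π| ≤ c * κ ^ n * arWeight x := by
  have := h.isMarkovKernel α
  set M : ℝ := (∫ y, |y| * ν y) / (1 - |α|) with hM
  have hM0 : 0 ≤ M := div_nonneg h.moment_nonneg (by linarith)
  obtain ⟨m, hm0, hmα, hsmall⟩ := h.exists_pow_forall_abs_integral_sub_le hα (8 * M + 8)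
  set β : ℝ := 1 / (12 * M + 8) with hβ
  have hβ0 : 0 < β := by positivity
  -- Large enough for both s ≥ 1 + M and sβ ≥ 1, which bound the oscillation of g below.
  set s : ℝ := 1 + M + 1 / β with hs
  have hs0 : 0 < s := by positivity
  have hsβ : 1 ≤ s * β := by
    have : 1 / β * β = 1 := by field_simp
    nlinarith [mul_nonneg (add_nonneg zero_le_one hM0) hβ0.le]
  set Mπ : ℝ := ∫ x, |x| ∂π with hMπ
  have hMπ0 : 0 ≤ Mπ := integral_nonneg fun x => abs_nonneg x
  set κ : ℝ := (15 / 16 : ℝ) ^ ((m : ℝ)⁻¹) with hκ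
  have hκ0 : 0 < κ := by positivity
  have hκm : κ ^ m = 15 / 16 := Real.rpow_inv_natCast_pow (by norm_num) hm0
  have hκ1 : κ < 1 := Real.rpow_lt_one (by norm_num) (by norm_num) (by positivity)
  have hdrift : ∀ x, ∫⁻ y, ENNReal.ofReal |y| ∂((arKernel ν α ^ m) x)
      ≤ ENNReal.ofReal (1 / 2 * |x| + M) := fun x =>
    (h.lintegral_abs_arKernel_pow_le hα m x).trans (ENNReal.ofReal_le_ofReal (by gcongr))
  refine ⟨16 / 15 * s * (2 + β + β * Mπ), κ, by positivity, hκ0, hκ1, fun n x f hf hfV => ?_⟩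
  have hfV' : ∀ y, ‖f y‖ ≤ 1 + 1 * |y| := fun y => by rw [one_mul]; exact hfV y
  have hint : ∀ n x, Integrable f ((arKernel ν α ^ n) x) := fun n x =>
    integrable_of_norm_le_add_mul (h.integrable_abs_arKernel_pow hα n x).1
      hf.stronglyMeasurable hfV'
  have hfπ : Integrable f π := integrable_of_norm_le_add_mul hπi hf.stronglyMeasurable hfV'
  -- Harris' theorem applies to the m-th power only. The n % m leftover steps are absorbed into the
  -- test function, with bounds uniform in n.
  set g : ℝ → ℝ := fun x => ∫ y, f y ∂((arKernel ν α ^ (n % m)) x) with hg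
  have hgm : Measurable g := hf.stronglyMeasurable.integral_kernel.measurable
  have hgb : ∀ y, |g y| ≤ 1 + M + |y| := fun y => by
    have hi := h.integrable_abs_arKernel_pow hα (n % m) y
    have h1 := norm_integral_le_add_mul hi.1 hi.2 zero_le_one hfV'
    have h2 : |α| ^ (n % m) * |y| ≤ |y| :=
      mul_le_of_le_one_left (abs_nonneg y) (pow_le_one₀ (abs_nonneg α) hα.le)
    rw [Real.norm_eq_abs] at h1
    linarith
  have hgs : ∀ x y, |g x - g y| ≤ s * (2 + β * |x| + β * |y|) := fun x y => by
    have h1 : |g x - g y| ≤ |g x| + |g y| := abs_sub _ _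
    have h2 := mul_le_mul_of_nonneg_right hsβ (abs_nonneg x)
    have h3 := mul_le_mul_of_nonneg_right hsβ (abs_nonneg y)
    have h4 : 0 < 1 / β := by positivity
    linarith [hgb x, hgb y]
  have hcontr := abs_integral_pow_sub_le_of_drift_of_small (arKernel ν α ^ m) (by fun_prop)
    (fun x => abs_nonneg x) hM0 hdrift hsmall hβ (n / m) hgm hs0.le hgs
  have hcomp : ∀ x, ∫ z, g z ∂(((arKernel ν α ^ m) ^ (n / m)) x)
      = ∫ y, f y ∂((arKernel ν α ^ n) x) := fun x => by
    have h1 := integral_pow_add (arKernel ν α) (n % m) (m * (n / m)) x (hint _ x)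
    rw [Nat.mod_add_div, pow_mul] at h1
    exact h1.symm
  simp only [hcomp] at hcontr
  have hPm : StronglyMeasurable fun y => ∫ z, f z ∂((arKernel ν α ^ n) y) :=
    hf.stronglyMeasurable.integral_kernel
  have hPi : Integrable (fun y => ∫ z, f z ∂((arKernel ν α ^ n) y)) π := by
    refine integrable_of_norm_le_add_mul (a := 1 + M) (b := 1) hπi hPm fun y => ?_
    have hi := h.integrable_abs_arKernel_pow hα n y
    have h1 := norm_integral_le_add_mul hi.1 hi.2 zero_le_one hfV'
    have h2 : |α| ^ n * |y| ≤ |y| :=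
      mul_le_of_le_one_left (abs_nonneg y) (pow_le_one₀ (abs_nonneg α) hα.le)
    linarith
  have hdiff : ∫ y, f y ∂((arKernel ν α ^ n) x) - ∫ y, f y ∂π
      = ∫ y, (∫ z, f z ∂((arKernel ν α ^ n) x) - ∫ z, f z ∂((arKernel ν α ^ n) y)) ∂π := by
    rw [integral_sub (integrable_const _) hPi,
      integral_kernel_of_invariant (invariant_pow hπ n) hfπ]
    simp
  rw [hdiff, ← Real.norm_eq_abs]
  refine (norm_integral_le_add_mul hπi le_rfl (a := (15 / 16) ^ (n / m) * s * (2 + β * |x|))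
    (b := (15 / 16) ^ (n / m) * s * β) (by positivity) fun y =>
      (hcontr x y).trans (le_of_eq (by ring))).trans ?_
  -- The factor 16/15 pays for rounding n/m down, since κ^m = 15/16.
  have hκn : (15 / 16 : ℝ) ^ (n / m) ≤ 16 / 15 * κ ^ n := by
    have h1 : κ ^ n = κ ^ (n % m) * (15 / 16) ^ (n / m) := by
      rw [← hκm, ← pow_mul, ← pow_add, Nat.mod_add_div]
    have h2 : 15 / 16 ≤ κ ^ (n % m) := by
      rw [← hκm]
      exact pow_le_pow_of_le_one hκ0.le hκ1.le (Nat.mod_lt n (Nat.pos_of_ne_zero hm0)).le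
    have h3 : (0 : ℝ) < (15 / 16) ^ (n / m) := by positivity
    rw [h1]
    nlinarith
  have hx : 2 + β * |x| + β * Mπ ≤ (2 + β + β * Mπ) * arWeight x := by
    have := abs_nonneg x
    rw [arWeight]
    nlinarith [mul_nonneg hβ0.le hMπ0, mul_nonneg (mul_nonneg hβ0.le hMπ0) this]
  calc (15 / 16) ^ (n / m) * s * (2 + β * |x|) + (15 / 16) ^ (n / m) * s * β * Mπ
      = (15 / 16) ^ (n / m) * (s * (2 + β * |x| + β * Mπ)) := by ring
    _ ≤ (16 / 15 * κ ^ n) * (s * ((2 + β + β * Mπ) * arWeight x)) := by gcongr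
    _ = _ := by ring

theorem exists_isVGeomErgodic {α : ℝ} (hα : |α| < 1) :
    ∃ π : Measure ℝ, IsVGeomErgodic arWeight (arKernel ν α) π ∧
      Integrable (fun x => |x|) π ∧ ∫ x, |x| ∂π ≤ (∫ y, |y| * ν y) / (1 - |α|) := by
  have := h.isMarkovKernel α
  obtain ⟨π, hπp, hπ, hπm⟩ := h.exists_invariant hα
  obtain ⟨hπi, hπM⟩ := integrable_and_integral_le_of_lintegral_le (by fun_prop)
    (fun x => abs_nonneg x) (div_nonneg h.moment_nonneg (by linarith)) hπm
  obtain ⟨c, κ, hc, hκ, hκ1, hgeom⟩ :=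
    h.exists_abs_integral_arKernel_pow_sub_integral_le hα hπ hπi
  refine ⟨π, ⟨hπp, hπ, fun π' _ hπ' => h.invariant_unique hα hπ hπ', ?_, c, κ, hc, hκ, hκ1,
    fun n x f hf hfV => ?_⟩, hπi, hπM⟩
  · have hV : Integrable arWeight π := (integrable_const 1).add hπi
    rw [← hasFiniteIntegral_iff_ofReal (ae_of_all _ fun x => by rw [arWeight]; positivity)]
    exact hV.2
  · have hfV' : ∀ y, ‖f y‖ ≤ 1 + 1 * |y| := fun y => by rw [one_mul]; exact hfV y
    exact norm_integral_sub_integral_le_of_real (hgeom n x) hf hfV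
      (integrable_of_norm_le_add_mul (h.integrable_abs_arKernel_pow hα n x).1
        hf.stronglyMeasurable hfV')
      (integrable_of_norm_le_add_mul hπi hf.stronglyMeasurable hfV')

end IsNoiseDensity

/-! ### Weighted norms, uniform drift and weak continuity in α. -/

theorem one_le_arWeight (x : ℝ) : 1 ≤ arWeight x := by
  rw [arWeight]
  linarith [abs_nonneg x]

theorem measurable_arWeight : Measurable arWeight := by
  unfold arWeight
  fun_prop

theorem weightedNorm_zero_le_one_iff {f : ℝ → ℂ} :
    weightedNorm arWeight 0 f ≤ 1 ↔ ∀ x, ‖f x‖ ≤ 1 := by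
  simp only [weightedNorm, neg_zero, Real.rpow_zero, ENNReal.ofReal_one, one_mul, iSup_le_iff,
    ← ofReal_norm, ENNReal.ofReal_le_one]

theorem weightedNorm_one_le_iff {f : ℝ → ℂ} {c : ℝ} (hc : 0 ≤ c) :
    weightedNorm arWeight 1 f ≤ ENNReal.ofReal c ↔ ∀ x, ‖f x‖ ≤ c * arWeight x := by
  rw [weightedNorm, iSup_le_iff]
  refine forall_congr' fun x => ?_
  have hV : 0 < arWeight x := zero_lt_one.trans_le (one_le_arWeight x)
  rw [← ofReal_norm, ← ENNReal.ofReal_mul (by positivity), ENNReal.ofReal_le_ofReal_iff hc,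
    Real.rpow_neg_one, inv_mul_le_iff₀ hV, mul_comm]

theorem tendsto_zero_of_forall_eventually_le_ofReal {ι : Type*} {l : Filter ι} {u : ι → ℝ≥0∞}
    (hu : ∀ η : ℝ, 0 < η → ∀ᶠ i in l, u i ≤ ENNReal.ofReal η) : Tendsto u l (𝓝 0) := by
  refine ENNReal.tendsto_nhds_zero.2 fun ε hε => ?_
  obtain ⟨η, hη0, hη, hηε⟩ := ENNReal.lt_iff_exists_real_btwn.1 hε
  filter_upwards [hu η (by simpa using hη)] with i hi using hi.trans hηε.le

namespace IsNoiseDensity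

variable {ν : ℝ → ℝ} (h : IsNoiseDensity ν)
include h

/-- Uniform drift condition. -/
theorem lintegral_arWeight_arKernel_le_of_abs_le {α δ : ℝ} (hα : |α| ≤ δ) (x : ℝ) :
    ∫⁻ y, ENNReal.ofReal (arWeight y) ∂(arKernel ν α x)
      ≤ ENNReal.ofReal (δ * arWeight x + (1 + ∫ y, |y| * ν y)) := by
  refine (h.lintegral_arWeight_arKernel_le α x).trans (ENNReal.ofReal_le_ofReal ?_)
  have h1 : |α| * |x| ≤ δ * |x| := by gcongr
  have h2 : 0 ≤ δ := (abs_nonneg α).trans hα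
  rw [arWeight]
  linarith

theorem eventually_norm_integral_arKernel_sub_le (α₀ : ℝ) {η : ℝ} (hη : 0 < η) :
    ∀ᶠ α in 𝓝 α₀, ∀ f : ℝ → ℂ, Measurable f → (∀ x, ‖f x‖ ≤ 1) → ∀ x,
      ‖∫ y, f y ∂(arKernel ν α x) - ∫ y, f y ∂(arKernel ν α₀ x)‖ ≤ η * arWeight x := by
  obtain ⟨K, hK0, hK⟩ := h.exists_norm_integral_translate_sub_le hη
  have hlim : Tendsto (fun α => K * |α - α₀|) (𝓝 α₀) (𝓝 0) := by
    have : Continuous fun α => K * |α - α₀| := by fun_prop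
    simpa using this.tendsto α₀
  filter_upwards [hlim.eventually (ge_mem_nhds hη)] with α hα f hf hf1 x
  rw [integral_arKernel ν α x hf.stronglyMeasurable, integral_arKernel ν α₀ x hf.stronglyMeasurable]
  refine (hK f hf hf1 _ _).trans ?_
  rw [← sub_mul, abs_mul, arWeight]
  nlinarith [mul_le_mul_of_nonneg_right hα (abs_nonneg x)]

theorem tendsto_opNorm_arKernel_sub (α₀ : ℝ) :
    Tendsto (fun α => opNorm arWeight 0 1 (kernelOp (arKernel ν α) - kernelOp (arKernel ν α₀)))
      (𝓝 α₀) (𝓝 0) := by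
  refine tendsto_zero_of_forall_eventually_le_ofReal fun η hη => ?_
  filter_upwards [h.eventually_norm_integral_arKernel_sub_le α₀ hη] with α hα
  refine iSup_le fun f => iSup₂_le fun hf hf1 => (weightedNorm_one_le_iff hη.le).2 fun x => ?_
  exact hα f hf (weightedNorm_zero_le_one_iff.1 hf1) x

/-- Telescoping: P_α^{n+1} - P_{α₀}^{n+1} = P_α(P_α^n - P_{α₀}^n) + (P_α - P_{α₀})P_{α₀}^n. The
first term costs the growth of V under P_α; in the second the test function stays bounded by 1. The
constant depends on n but not on α or η. -/
theorem exists_norm_integral_arKernel_pow_sub_le (α₀ : ℝ) (n : ℕ) :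
    ∃ C : ℝ, 0 ≤ C ∧ ∀ α η : ℝ, |α| < 1 → 0 ≤ η →
      (∀ f : ℝ → ℂ, Measurable f → (∀ x, ‖f x‖ ≤ 1) → ∀ x,
        ‖∫ y, f y ∂(arKernel ν α x) - ∫ y, f y ∂(arKernel ν α₀ x)‖ ≤ η * arWeight x) →
      ∀ f : ℝ → ℂ, Measurable f → (∀ x, ‖f x‖ ≤ 1) → ∀ x,
        ‖∫ y, f y ∂((arKernel ν α ^ n) x) - ∫ y, f y ∂((arKernel ν α₀ ^ n) x)‖
          ≤ C * η * arWeight x := by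
  have := h.isMarkovKernel α₀
  induction n with
  | zero => exact ⟨0, le_rfl, fun α η _ _ _ f _ _ x => by simp⟩
  | succ n ih =>
    obtain ⟨C, hC0, hC⟩ := ih
    set m : ℝ := ∫ y, |y| * ν y
    have hm : 0 ≤ m := h.moment_nonneg
    refine ⟨C * (1 + m) + 1, by positivity, fun α η hα hη hη' f hf hf1 x => ?_⟩
    have := h.isMarkovKernel α
    have hfi : ∀ α' x, IsMarkovKernel (arKernel ν α') →
        Integrable f ((arKernel ν α' ^ (n + 1)) x) := fun α' x _ =>
      integrable_of_norm_le hf.stronglyMeasurable hf1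
    rw [integral_pow_succ _ _ _ (hfi α x this), integral_pow_succ _ _ _ (hfi α₀ x ‹_›)]
    set A : ℝ → ℂ := fun y => ∫ z, f z ∂((arKernel ν α ^ n) y)
    set B : ℝ → ℂ := fun y => ∫ z, f z ∂((arKernel ν α₀ ^ n) y)
    have hA : StronglyMeasurable A := hf.stronglyMeasurable.integral_kernel
    have hB : StronglyMeasurable B := hf.stronglyMeasurable.integral_kernel
    have hA1 : ∀ y, ‖A y‖ ≤ 1 := fun y => norm_integral_le_of_forall_norm_le hf1
    have hB1 : ∀ y, ‖B y‖ ≤ 1 := fun y => norm_integral_le_of_forall_norm_le hf1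
    have hx := abs_nonneg x
    obtain ⟨hWi, hWm⟩ := integrable_and_integral_le_of_lintegral_le measurable_abs
      (fun y => abs_nonneg y) (by positivity) (h.lintegral_abs_arKernel_le α x)
    have hAB : ‖∫ y, A y ∂(arKernel ν α x) - ∫ y, B y ∂(arKernel ν α x)‖
        ≤ C * η * (1 + m) * arWeight x := by
      rw [← integral_sub (integrable_of_norm_le hA hA1) (integrable_of_norm_le hB hB1)]
      refine (norm_integral_le_add_mul hWi hWm (a := C * η) (b := C * η) (by positivity)
        fun y => (hC α η hα hη hη' f hf hf1 y).trans (le_of_eq (by rw [arWeight]; ring))).trans ?_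
      have h1 : |α| * |x| ≤ |x| := mul_le_of_le_one_left hx hα.le
      have h2 : 1 + (|α| * |x| + m) ≤ (1 + m) * arWeight x := by
        rw [arWeight]
        nlinarith [mul_nonneg hm hx]
      calc C * η + C * η * (|α| * |x| + m) = C * η * (1 + (|α| * |x| + m)) := by ring
        _ ≤ C * η * ((1 + m) * arWeight x) := by gcongr
        _ = _ := by ring
    calc ‖∫ y, A y ∂(arKernel ν α x) - ∫ y, B y ∂(arKernel ν α₀ x)‖
        ≤ ‖∫ y, A y ∂(arKernel ν α x) - ∫ y, B y ∂(arKernel ν α x)‖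
          + ‖∫ y, B y ∂(arKernel ν α x) - ∫ y, B y ∂(arKernel ν α₀ x)‖ :=
          norm_sub_le_norm_sub_add_norm_sub _ _ _
      _ ≤ C * η * (1 + m) * arWeight x + η * arWeight x :=
          add_le_add hAB (hη' B hB.measurable hB1 x)
      _ = _ := by ring

/-- Here ε and K come from the noise alone, so the estimate is uniform over |α| ≤ r < 1 once the
moments of the invariant laws are bounded. -/
theorem norm_integral_invariant_sub_le {α : ℝ} {ε K : ℝ} (hK0 : 0 ≤ K)
    (hK : ∀ f : ℝ → ℂ, Measurable f → (∀ x, ‖f x‖ ≤ 1) → ∀ z z' : ℝ,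
      ‖∫ y, f (z + y) ∂(noiseLaw ν) - ∫ y, f (z' + y) ∂(noiseLaw ν)‖ ≤ ε + K * |z - z'|)
    {π : Measure ℝ} [IsProbabilityMeasure π] (hπ : (arKernel ν α).Invariant π)
    (hπi : Integrable (fun x => |x|) π) (n : ℕ) {f : ℝ → ℂ} (hf : Measurable f)
    (hf1 : ∀ x, ‖f x‖ ≤ 1) :
    ‖∫ x, f x ∂π - ∫ y, f y ∂((arKernel ν α ^ (n + 1)) 0)‖
      ≤ ε + K * |α| ^ (n + 1) * ∫ x, |x| ∂π := by
  have := h.isMarkovKernel α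
  rw [← integral_kernel_of_invariant (invariant_pow hπ (n + 1))
    (integrable_of_norm_le hf.stronglyMeasurable hf1)]
  have hm : StronglyMeasurable fun x => ∫ y, f y ∂((arKernel ν α ^ (n + 1)) x) :=
    hf.stronglyMeasurable.integral_kernel
  have hc : ∫ y, f y ∂((arKernel ν α ^ (n + 1)) 0)
      = ∫ _, ∫ y, f y ∂((arKernel ν α ^ (n + 1)) 0) ∂π := by simp
  rw [hc, ← integral_sub
    (integrable_of_norm_le hm fun x => norm_integral_le_of_forall_norm_le hf1)
    (integrable_const _)]
  refine norm_integral_le_add_mul hπi le_rfl (by positivity) fun x => ?_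
  refine (h.norm_integral_arKernel_pow_sub_le α hK n hf hf1 x 0).trans (le_of_eq ?_)
  rw [sub_zero, mul_assoc]

theorem tendsto_tvNorm_invariant {π : ℝ → Measure ℝ}
    (hπp : ∀ α, |α| < 1 → IsProbabilityMeasure (π α))
    (hπ : ∀ α, |α| < 1 → (arKernel ν α).Invariant (π α))
    (hπi : ∀ α, |α| < 1 → Integrable (fun x => |x|) (π α))
    (hπm : ∀ α, |α| < 1 → ∫ x, |x| ∂(π α) ≤ (∫ y, |y| * ν y) / (1 - |α|))
    {α₀ : ℝ} (hα₀ : |α₀| < 1) :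
    Tendsto (fun α => tvNorm (π α) (π α₀)) (𝓝 α₀) (𝓝 0) := by
  refine tendsto_zero_of_forall_eventually_le_ofReal fun η hη => ?_
  obtain ⟨r, hr, hr1⟩ := exists_between hα₀
  have hr0 : 0 < r := (abs_nonneg α₀).trans_lt hr
  have hm := h.moment_nonneg
  set m : ℝ := ∫ y, |y| * ν y
  obtain ⟨K, hK0, hK⟩ := h.exists_norm_integral_translate_sub_le (show 0 < η / 8 by positivity)
  have hM0 : 0 ≤ m / (1 - r) := div_nonneg hm (by linarith)
  obtain ⟨n, hn⟩ : ∃ n : ℕ, K * r ^ (n + 1) * (m / (1 - r)) ≤ η / 8 := by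
    have hlim := ((((tendsto_pow_atTop_nhds_zero_of_lt_one hr0.le hr1).comp
      (tendsto_add_atTop_nat 1)).const_mul K).mul_const (m / (1 - r)))
    rw [mul_zero, zero_mul] at hlim
    exact (hlim.eventually (ge_mem_nhds (show 0 < η / 8 by positivity))).exists
  -- Used at α and at α₀ with the same n; the two tails cost η/4 each and the comparison of n-step
  -- laws costs η/2.
  have htail : ∀ α, |α| < r → ∀ f : ℝ → ℂ, Measurable f → (∀ x, ‖f x‖ ≤ 1) →
      ‖∫ x, f x ∂(π α) - ∫ y, f y ∂((arKernel ν α ^ (n + 1)) 0)‖ ≤ η / 4 := by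
    intro α hα f hf hf1
    have hα1 := hα.trans hr1
    have := hπp α hα1
    refine (h.norm_integral_invariant_sub_le hK0 hK (hπ α hα1) (hπi α hα1) n hf hf1).trans ?_
    have h1 : ∫ x, |x| ∂(π α) ≤ m / (1 - r) :=
      (hπm α hα1).trans (div_le_div_of_nonneg_left hm (by linarith) (by linarith))
    have h2 : K * |α| ^ (n + 1) * ∫ x, |x| ∂(π α) ≤ K * r ^ (n + 1) * (m / (1 - r)) := by
      gcongr
    linarith
  obtain ⟨C, hC0, hC⟩ := h.exists_norm_integral_arKernel_pow_sub_le α₀ (n + 1)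
  have hη' : 0 < η / (2 * (C + 1)) := by positivity
  filter_upwards [h.eventually_norm_integral_arKernel_sub_le α₀ hη',
    continuous_abs.continuousAt.eventually (gt_mem_nhds hr)] with α hα hαr
  refine iSup_le fun f => iSup₂_le fun hf hf1 => ?_
  rw [← ofReal_norm]
  refine ENNReal.ofReal_le_ofReal ?_
  have h1 := htail α hαr f hf hf1
  have h2 := htail α₀ hr f hf hf1
  have h3 := hC α _ (hαr.trans hr1) hη'.le hα f hf hf1 0
  have h4 : C * (η / (2 * (C + 1))) * arWeight 0 ≤ η / 2 := by
    rw [arWeight, abs_zero, add_zero, mul_one, mul_div_assoc', div_le_iff₀ (by positivity)]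
    nlinarith
  rw [norm_sub_rev] at h2
  set a := ∫ x, f x ∂(π α)
  set b := ∫ y, f y ∂((arKernel ν α ^ (n + 1)) 0)
  set b₀ := ∫ y, f y ∂((arKernel ν α₀ ^ (n + 1)) 0)
  set a₀ := ∫ x, f x ∂(π α₀)
  linarith [norm_sub_le_norm_sub_add_norm_sub a b a₀, norm_sub_le_norm_sub_add_norm_sub b b₀ a₀]

/-! ### Failure of strong continuity away from zero. -/

theorem exists_measureReal_compl_le :
    ∃ R : ℝ, 0 < R ∧ (noiseLaw ν).real {y | |y| ≤ R}ᶜ ≤ 1 / 4 := by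
  have := h.isProbabilityMeasure
  have hm := h.moment_nonneg
  set m : ℝ := ∫ y, |y| * ν y
  obtain ⟨hi, hle⟩ := integrable_and_integral_le_of_lintegral_le measurable_abs
    (fun y => abs_nonneg y) hm h.lintegral_abs.le
  refine ⟨4 * m + 1, by positivity, ?_⟩
  have h1 := mul_meas_ge_le_integral_of_nonneg (ae_of_all _ fun y => abs_nonneg y) hi (4 * m + 1)
  have h2 : (noiseLaw ν).real {y | |y| ≤ 4 * m + 1}ᶜ
      ≤ (noiseLaw ν).real {y | 4 * m + 1 ≤ |y|} :=
    measureReal_mono fun y (hy : ¬ |y| ≤ 4 * m + 1) => (not_le.1 hy).le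
  have h3 : (4 * m + 1) * (noiseLaw ν).real {y | |y| ≤ 4 * m + 1}ᶜ ≤ m :=
    (mul_le_mul_of_nonneg_left h2 (by positivity)).trans (h1.trans hle)
  by_contra hc
  nlinarith

/-- The test function is V cut off to the window of radius R around αx. The law from x under α gives
this window mass at least 3/4; under α₀ it gives at most 1/4. The lower bound does not involve α -
α₀. -/
theorem exists_norm_integral_arKernel_sub_ge {α α₀ : ℝ} (hα0 : α ≠ 0) (hα1 : |α| ≤ 1)
    (hne : α ≠ α₀) :
    ∃ (f : ℝ → ℂ) (x : ℝ), Measurable f ∧ (∀ y, ‖f y‖ ≤ arWeight y) ∧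
      |α| / 4 * arWeight x ≤ ‖∫ y, f y ∂(arKernel ν α x) - ∫ y, f y ∂(arKernel ν α₀ x)‖ := by
  have := h.isProbabilityMeasure
  obtain ⟨R, hR, hRm⟩ := h.exists_measureReal_compl_le
  set S : Set ℝ := {y | |y| ≤ R} with hS
  have hSm : MeasurableSet S := measurableSet_le (by fun_prop) measurable_const
  have hα : 0 < |α| := abs_pos.2 hα0
  have hd : 0 < |α₀ - α| := abs_pos.2 (sub_ne_zero.2 hne.symm)
  -- The first term puts αx and α₀x more than 2R apart, so their R-windows are disjoint; the second
  -- makes |α|x ≥ 4R, so that |α|x/2 - R ≥ |α|x/4 at the end.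
  set x : ℝ := 3 * R / |α₀ - α| + 4 * R / |α| with hx
  have hx0 : 0 < x := by positivity
  have hxα : 4 * R ≤ |α| * x := by
    have h1 : |α| * x = |α| * (3 * R / |α₀ - α|) + 4 * R := by rw [hx]; field_simp
    have h2 : 0 ≤ |α| * (3 * R / |α₀ - α|) := by positivity
    linarith
  have hxd : 2 * R < |(α₀ - α) * x| := by
    have h1 : |α₀ - α| * x = 3 * R + |α₀ - α| * (4 * R / |α|) := by rw [hx]; field_simp
    have h2 : 0 ≤ |α₀ - α| * (4 * R / |α|) := by positivity
    rw [abs_mul, abs_of_pos hx0]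
    linarith
  have hαx : |α * x| = |α| * x := by rw [abs_mul, abs_of_pos hx0]
  set T : Set ℝ := {y | |y - α * x| ≤ R} with hT
  have hTm : MeasurableSet T := measurableSet_le (by fun_prop) measurable_const
  set g : ℝ → ℝ := T.indicator arWeight with hg
  have hgm : Measurable g := measurable_arWeight.indicator hTm
  have hg0 : ∀ y, 0 ≤ g y :=
    indicator_nonneg fun y _ => zero_le_one.trans (one_le_arWeight y)
  have hgle : ∀ y, g y ≤ 1 + |α| * x + R := fun y => by
    by_cases hy : y ∈ T
    · rw [hg, indicator_of_mem hy, arWeight, ← hαx]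
      have h1 : |y - α * x| ≤ R := hy
      linarith [abs_sub_abs_le_abs_sub y (α * x)]
    · rw [hg, indicator_of_notMem hy]
      positivity
  have hgi : ∀ z, Integrable (fun y => g (z + y)) (noiseLaw ν) := fun z =>
    integrable_of_norm_le (hgm.comp (by fun_prop)).stronglyMeasurable (C := 1 + |α| * x + R)
      fun y => by rw [Real.norm_eq_abs, abs_of_nonneg (hg0 _)]; exact hgle _
  have hlower : (1 + |α| * x - R) * (3 / 4) ≤ ∫ y, g (α * x + y) ∂(noiseLaw ν) := by
    have h1 : (noiseLaw ν).real S • (1 + |α| * x - R) ≤ ∫ y, g (α * x + y) ∂(noiseLaw ν) := by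
      rw [← integral_indicator_const _ hSm]
      refine integral_mono ((integrable_const _).indicator hSm) (hgi _) fun y => ?_
      by_cases hy : y ∈ S
      · have hy' : α * x + y ∈ T := by
          change |α * x + y - α * x| ≤ R
          rw [add_sub_cancel_left]
          exact hy
        simp only [hg, indicator_of_mem hy, indicator_of_mem hy', arWeight]
        have h1 : |y| ≤ R := hy
        have h2 := abs_sub_abs_le_abs_sub (α * x) (-y)
        rw [abs_neg, sub_neg_eq_add, hαx] at h2
        linarith
      · simp only [indicator_of_notMem hy]
        exact hg0 _
    have h2 : 3 / 4 ≤ (noiseLaw ν).real S := by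
      have := probReal_add_probReal_compl (μ := noiseLaw ν) hSm
      linarith
    rw [smul_eq_mul] at h1
    nlinarith
  have hupper : ∫ y, g (α₀ * x + y) ∂(noiseLaw ν) ≤ (1 + |α| * x + R) * (1 / 4) := by
    have h1 : ∫ y, g (α₀ * x + y) ∂(noiseLaw ν)
        ≤ (noiseLaw ν).real Sᶜ • (1 + |α| * x + R) := by
      rw [← integral_indicator_const _ hSm.compl]
      refine integral_mono (hgi _) ((integrable_const _).indicator hSm.compl) fun y => ?_
      by_cases hy : y ∈ S
      · have hy' : α₀ * x + y ∉ T := fun hy' => by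
          have h1 : |y| ≤ R := hy
          have h2 : |α₀ * x + y - α * x| ≤ R := hy'
          have h3 : (α₀ - α) * x = (α₀ * x + y - α * x) - y := by ring
          have h4 := abs_sub (α₀ * x + y - α * x) y
          rw [← h3] at h4
          linarith
        simp [hg, indicator_of_notMem hy', hy]
      · rw [indicator_of_mem (show y ∈ Sᶜ from hy)]
        exact hgle _
    rw [smul_eq_mul] at h1
    have h2 : 0 < 1 + |α| * x + R := by positivity
    nlinarith
  refine ⟨fun y => (g y : ℂ), x, Complex.measurable_ofReal.comp hgm, fun y => ?_, ?_⟩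
  · rw [Complex.norm_real, Real.norm_eq_abs, abs_of_nonneg (hg0 y)]
    exact indicator_le_self' (fun y _ => zero_le_one.trans (one_le_arWeight y)) y
  · rw [integral_complex_ofReal, integral_complex_ofReal,
      integral_arKernel ν α x hgm.stronglyMeasurable,
      integral_arKernel ν α₀ x hgm.stronglyMeasurable, ← Complex.ofReal_sub, Complex.norm_real]
    refine le_trans ?_ (le_abs_self _)
    rw [arWeight, abs_of_pos hx0]
    linarith

theorem opNorm_arKernel_sub_ge {α α₀ : ℝ} (hα0 : α ≠ 0) (hα1 : |α| ≤ 1) (hne : α ≠ α₀) :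
    ENNReal.ofReal (|α| / 4)
      ≤ opNorm arWeight 1 1 (kernelOp (arKernel ν α) - kernelOp (arKernel ν α₀)) := by
  obtain ⟨f, x, hf, hfV, hfx⟩ := h.exists_norm_integral_arKernel_sub_ge hα0 hα1 hne
  have hf1 : weightedNorm arWeight 1 f ≤ 1 := by
    rw [← ENNReal.ofReal_one]
    exact (weightedNorm_one_le_iff zero_le_one).2 fun y => by rw [one_mul]; exact hfV y
  refine le_trans ?_ (le_iSup_of_le f (le_iSup₂_of_le hf hf1 (le_iSup _ x)))
  have hV : 0 < arWeight x := zero_lt_one.trans_le (one_le_arWeight x)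
  rw [← ofReal_norm, ← ENNReal.ofReal_mul (by positivity), Real.rpow_neg_one]
  refine ENNReal.ofReal_le_ofReal ?_
  rw [inv_mul_eq_div, le_div_iff₀ hV]
  exact hfx

/-- Near α₀ one has |α| > |α₀|/2, so the operator norm stays above |α₀|/8. The general filter covers
both one-sided limits. -/
theorem not_tendsto_opNorm_arKernel_sub {α₀ : ℝ} (hα₀ : |α₀| < 1) (h0 : α₀ ≠ 0) {l : Filter ℝ}
    [l.NeBot] (hl : l ≤ 𝓝[≠] α₀) :
    ¬ Tendsto (fun α => opNorm arWeight 1 1 (kernelOp (arKernel ν α) - kernelOp (arKernel ν α₀)))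
      l (𝓝 0) := by
  intro ht
  have hpos : 0 < |α₀| := abs_pos.2 h0
  have hlt : (0 : ℝ≥0∞) < ENNReal.ofReal (|α₀| / 8) := by simpa using h0
  have hl' : l ≤ 𝓝 α₀ := hl.trans nhdsWithin_le_nhds
  have e1 : ∀ᶠ α in l, |α| ≤ 1 := hl' (continuous_abs.continuousAt.eventually (ge_mem_nhds hα₀))
  have e2 : ∀ᶠ α in l, |α₀| / 2 < |α| :=
    hl' (continuous_abs.continuousAt.eventually (lt_mem_nhds (half_lt_self hpos)))
  have e3 : ∀ᶠ α in l, α ≠ α₀ := hl self_mem_nhdsWithin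
  obtain ⟨α, h1, h2, h3, h4⟩ :=
    (e1.and (e2.and (e3.and (ht.eventually (gt_mem_nhds hlt))))).exists
  have h5 : α ≠ 0 := abs_pos.1 ((half_pos hpos).trans h2)
  refine absurd h4 (not_lt.2 (le_trans ?_ (h.opNorm_arKernel_sub_ge h5 h1 h3)))
  exact ENNReal.ofReal_le_ofReal (by linarith)

end IsNoiseDensity

end MarkovPerturbation

theorem mainTheorem4 (ν : ℝ → ℝ) (hν_meas : Measurable ν) (hν_nonneg : ∀ y, 0 ≤ ν y)
    (hν_int : ∫ y, ν y = 1) (hν_moment : Integrable fun y => |y| * ν y) :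
    -- geometric ergodicity and continuity of the invariant distributions in total variation
    (∃ π : ℝ → Measure ℝ,
      (∀ α ∈ Ioo (-1 : ℝ) 1, IsVGeomErgodic arWeight
        (arKernel ν α) (π α)) ∧
      ∀ α₀ ∈ Ioo (-1 : ℝ) 1,
        Tendsto (fun α => tvNorm (π α) (π α₀)) (𝓝 α₀) (𝓝 0)) ∧
    -- uniform drift condition
    (∀ a₀ ∈ Ioo (0 : ℝ) 1, ∀ δ ∈ Ioo a₀ 1, ∃ L : ℝ, 0 < L ∧ ∀ α ∈ Ioo (-a₀) a₀, ∀ x : ℝ,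
      ∫⁻ y, ENNReal.ofReal (arWeight y) ∂(arKernel ν α x) ≤
        ENNReal.ofReal (δ * arWeight x + L)) ∧
    -- weak continuity condition
    (∀ α₀ ∈ Ioo (-1 : ℝ) 1,
      Tendsto (fun α => opNorm arWeight 0 1
        (kernelOp (arKernel ν α) -
          kernelOp (arKernel ν α₀))) (𝓝 α₀) (𝓝 0)) ∧
    -- failure of the strong continuity condition, on either side of a nonzero parameter
    (∀ α₀ ∈ Ioo (-1 : ℝ) 1, α₀ ≠ 0 →
      ¬ Tendsto (fun α => opNorm arWeight 1 1
        (kernelOp (arKernel ν α) -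
          kernelOp (arKernel ν α₀))) (𝓝[>] α₀) (𝓝 0) ∧
      ¬ Tendsto (fun α => opNorm arWeight 1 1
        (kernelOp (arKernel ν α) -
          kernelOp (arKernel ν α₀))) (𝓝[<] α₀) (𝓝 0)) := by
  have h : IsNoiseDensity ν := ⟨hν_meas, hν_nonneg, hν_int, hν_moment⟩
  refine ⟨?_, ?_, fun α₀ _ => h.tendsto_opNorm_arKernel_sub α₀, fun α₀ hα₀ h0 => ⟨?_, ?_⟩⟩
  · choose! π hπ using fun (α : ℝ) (hα : |α| < 1) => h.exists_isVGeomErgodic hα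
    exact ⟨π, fun α hα => (hπ α (abs_lt.2 hα)).1, fun α₀ hα₀ =>
      h.tendsto_tvNorm_invariant (fun α hα => (hπ α hα).1.isProbabilityMeasure)
        (fun α hα => (hπ α hα).1.invariant) (fun α hα => (hπ α hα).2.1)
        (fun α hα => (hπ α hα).2.2) (abs_lt.2 hα₀)⟩
  · intro a₀ _ δ hδ
    refine ⟨1 + ∫ y, |y| * ν y, by linarith [h.moment_nonneg], fun α hα x => ?_⟩
    exact h.lintegral_arWeight_arKernel_le_of_abs_le ((abs_lt.2 hα).le.trans hδ.1.le) x
  · exact h.not_tendsto_opNorm_arKernel_sub (abs_lt.2 hα₀) h0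
      (nhdsWithin_mono _ fun x (hx : α₀ < x) => hx.ne')
  · exact h.not_tendsto_opNorm_arKernel_sub (abs_lt.2 hα₀) h0
      (nhdsWithin_mono _ fun x (hx : x < α₀) => hx.ne)
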